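/- **Setting.** Fix $T>0$, $s_0>0$, $\mu\in\mathbb R$. A *fractional Brownian motion* (fBm) $B=(B_t)_{t\in[0,T]}$ with Hurst index $H\in(0,1)$ is a centered Gaussian process with $B_0=0$ and $\mathrm{Cov}[B_t,B_s]=\frac12\left(t^{2H}+s^{2H}-|t-s|^{2H}\right)$; for $H=1/2$ it is called a Brownian motion (Bm) $W$. Consider the following discounted stock-price models $S=(S_t)_{t\in[0,T]}$ (with continuous paths): 1. Black–Scholes (BS): $S_t=s_0e^{\mu t+\sigma W_t-\frac12\sigma^2t}$, with $W$ a Bm and $\sigma>0$; 2. fractional Black–Scholes (fBS): $S_t=s_0e^{\mu t+\nu B_t}$, with $B$ an fBm of index $H\in(0,1)$, $H\neq\frac12$, and $\nu>0$; 3. mixed fractional Black–Scholes (mfBS): $S_t=s_0e^{\mu t+\sigma W_t-\frac12\sigma^2t+\nu B_t}$, with $W$ a Bm and $B$ an fBm of index $H\in(0,1)$, $H\ne\frac12$, independent of $W$, and $\sigma,\nu>0$. For real $a\le b$ and $x>0$ let $C_x^+([a,b])$ be the space of positive continuous functions on $[a,b]$ with value $x$ at $a$, with the supremum distance. We work on $\Omega=C^+_{s_0}([0,T])$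 with co-ordinate process $S_t(\omega)=\omega_t$, with $\mathbb P$ the law of one of the models, and with $(\mathcal F_t)_{t\in[0,T]}$ the filtration generated by $S$, augmented to satisfy the usual conditions (completeness and right-continuity). **Delay property.** A non-decreasing sequence of stopping times $0\le\tau_0\le\dots\le\tau_n\le T$ has the delay property if for every $k<n$ there are an $\mathcal F_{\tau_k}$-measurable random set $U_k$, which is an open subset of $C^+_{S_{\tau_k}}([\tau_k,T])$ and is almost surely non-empty, and an $\mathcal F_{\tau_k}$-measurable, a.s. positive random variable $\varepsilon_k$ such that $\tau_{k+1}-\tau_k\ge\varepsilon_k$ almost surely on the event $\{(S_t)_{t\in[\tau_k,T]}\in U_k\}\cap\{\tau_{k+1}>\tau_k\}$. (Measurability of $U_k$ means: the set of pairs $(\omega,\omega')\in\Omega\times\Omega$ with $\omega'|_{[\tau_k(\omega),T]}\in U_k(\omega)$ belongs to the product of $\mathcal F_{\tau_k}$ and the $\sigma$-algebra on $\Omega$ generated by the co-ordinates.) **Delay-simple strategies.** A portfolio is a pair of adapted processes $\mathbf\Phi=(\Phi^0_t,\Phi_t)_{t\in[0,T]}$, with value $V_t(\mathbf\Phi)=\Phi^0_t+\Phi_tS_t$.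 It is delay-simple if there are stopping times $\tau_0\le\dots\le\tau_n$ with the delay property such that $$\Phi_t=\sum_{k=0}^{n-1}\phi_{\tau_k}\mathbf 1_{(\tau_k,\tau_{k+1}]}(t),\qquad \phi_{\tau_k}\ \ \mathcal F_{\tau_k}\text{-measurable},$$ $\Phi^0$ is likewise piecewise constant, equal to an $\mathcal F_0$-measurable variable on $[0,\tau_0]$ and to $\mathcal F_{\tau_k}$-measurable variables on $(\tau_k,\tau_{k+1}]$ for $0\le k\le n-1$ and, for $k=n$, on $(\tau_n,T]$, and $\mathbf\Phi$ is self-financing: almost surely, for every $k\le n$, with $\tau_{n+1}:=T$, $$V_{\tau_{k+1}}(\mathbf\Phi)-V_{\tau_k}(\mathbf\Phi)=\Phi_{\tau_{k+1}}(S_{\tau_{k+1}}-S_{\tau_k}).$$ A portfolio is an *arbitrage* if $V_0(\mathbf\Phi)=0$ a.s., $V_T(\mathbf\Phi)\ge0$ a.s. and $\mathbb P[V_T(\mathbf\Phi)>0]>0$. **Theorem.** In each of the models BS, fBS and mfBS no delay-simple strategy is an arbitrage. -/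

import Mathlib

open MeasureTheory ProbabilityTheory Set Filter
open scoped Topology

noncomputable section

namespace DelaySimple

/-! ### Path spaces -/

/-- The space `C⁺_x([a, b])` of positive continuous functions on `[a, b]` which start from `x` at
time `a`. -/
def PosPath (a b x : ℝ) : Type :=
  {f : C(Set.Icc a b, ℝ) // (∀ t, 0 < f t) ∧ ∀ t : Set.Icc a b, (t : ℝ) = a → f t = x}

instance (a b x : ℝ) : CoeFun (PosPath a b x) (fun _ => Set.Icc a b → ℝ) where
  coe f := f.1

/-- The supremum distance; it induces the topology of uniform convergence. -/
instance (a b x : ℝ) : MetricSpace (PosPath a b x) :=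
  inferInstanceAs (MetricSpace
    {f : C(Set.Icc a b, ℝ) // (∀ t, 0 < f t) ∧ ∀ t : Set.Icc a b, (t : ℝ) = a → f t = x})

/-- The σ-algebra generated by the co-ordinate maps. -/
instance PosPath.cylinderSigma (a b x : ℝ) : MeasurableSpace (PosPath a b x) :=
  ⨆ t : Set.Icc a b, MeasurableSpace.comap (fun f : PosPath a b x => f t) inferInstance

/-- The restriction of a path on `[a, b]` to `[c, b]`, a path which starts from `y = f c`. -/
def PosPath.tail {a b x : ℝ} (f : PosPath a b x) (c : Set.Icc a b) (y : ℝ) (hy : f c = y) :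
    PosPath c b y :=
  ⟨⟨fun t => f ⟨t, c.2.1.trans t.2.1, t.2.2⟩,
      f.1.continuous.comp (Continuous.subtype_mk continuous_subtype_val _)⟩,
    fun _ => f.2.1 _, fun t ht => by
      have : (⟨t, c.2.1.trans t.2.1, t.2.2⟩ : Set.Icc a b) = c := Subtype.ext ht
      simpa [this] using hy⟩

/-! ### The canonical stochastic basis -/

section Basis

variable {T s₀ : ℝ}

/-- The completion under `P` of the σ-algebra of the path space. -/
abbrev completedSigma (P : Measure (PosPath 0 T s₀)) : MeasurableSpace (PosPath 0 T s₀) :=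
  inferInstanceAs (MeasurableSpace (NullMeasurableSpace (PosPath 0 T s₀) P))

/-- The filtration generated by the co-ordinate process and the `P`-null sets. -/
def completedFiltration (P : Measure (PosPath 0 T s₀)) :
    Filtration (Set.Icc (0 : ℝ) T) (completedSigma P) where
  seq t := (⨆ s : Set.Icc (0 : ℝ) T, ⨆ _ : s ≤ t,
      MeasurableSpace.comap (fun ω : PosPath 0 T s₀ => ω s) inferInstance) ⊔
    MeasurableSpace.generateFrom {N | P N = 0}
  mono' _ _ hst := by
    refine sup_le_sup_right (iSup₂_le fun s hs => ?_) _
    exact le_iSup₂_of_le (f := fun (s : Set.Icc (0 : ℝ) T) (_ : s ≤ _) =>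
      MeasurableSpace.comap (fun ω : PosPath 0 T s₀ => ω s) inferInstance) s (hs.trans hst) le_rfl
  le' t := by
    refine sup_le (iSup₂_le fun s _ => ?_) (MeasurableSpace.generateFrom_le ?_)
    · intro A hA
      have h1 : MeasurableSet A := (le_iSup (fun t : Set.Icc (0 : ℝ) T =>
        MeasurableSpace.comap (fun f : PosPath 0 T s₀ => f t) inferInstance) s) A hA
      exact h1.nullMeasurableSet
    · intro N hN
      exact NullMeasurableSet.of_null hN

/-- The filtration generated by the stock price (the co-ordinate process), augmented to satisfy
the usual conditions of completeness and right-continuity. -/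
def usualFiltration (P : Measure (PosPath 0 T s₀)) :
    Filtration (Set.Icc (0 : ℝ) T) (completedSigma P) :=
  (completedFiltration P).rightCont

/-- A non-decreasing sequence `0 ≤ τ₀ ≤ ⋯ ≤ τₙ ≤ T` of stopping times. -/
structure StoppingSeq (P : Measure (PosPath 0 T s₀)) (n : ℕ) where
  time : Fin (n + 1) → PosPath 0 T s₀ → Set.Icc (0 : ℝ) T
  isStoppingTime : ∀ k,
    IsStoppingTime (usualFiltration P) (fun ω => (time k ω : WithTop (Set.Icc (0 : ℝ) T)))
  monotone : ∀ ω, Monotone fun k => time k ω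

/-- The σ-algebra of the events prior to `τₖ`. -/
abbrev StoppingSeq.sigma {P : Measure (PosPath 0 T s₀)} {n : ℕ} (τ : StoppingSeq P n)
    (k : Fin (n + 1)) : MeasurableSpace (PosPath 0 T s₀) :=
  (τ.isStoppingTime k).measurableSpace

/-- The delay property. For each `k < n` there are a random non-empty open set `U` of positive
continuous paths on `[τₖ, T]` starting from `S_{τₖ}`, and a random variable `ε > 0`, both
measurable with respect to the σ-algebra of `τₖ`, such that `τₖ₊₁ - τₖ ≥ ε` on the event that
`τₖ₊₁ > τₖ` and the price path on `[τₖ, T]` belongs to `U`. Measurability of the random set `U`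
is measurability of its graph, where paths on `[τₖ, T]` are given as restrictions of paths on
`[0, T]`. -/
def StoppingSeq.HasDelay {P : Measure (PosPath 0 T s₀)} {n : ℕ} (τ : StoppingSeq P n) : Prop :=
  ∀ k : Fin n,
    ∃ (U : (ω : PosPath 0 T s₀) →
        Set (PosPath (τ.time k.castSucc ω) T (ω (τ.time k.castSucc ω))))
      (ε : PosPath 0 T s₀ → ℝ),
      (∀ ω, IsOpen (U ω)) ∧
      (∀ᵐ ω ∂P, (U ω).Nonempty) ∧
      MeasurableSet[(τ.sigma k.castSucc).prod (PosPath.cylinderSigma 0 T s₀)]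
        {p : PosPath 0 T s₀ × PosPath 0 T s₀ |
          ∃ h : p.2 (τ.time k.castSucc p.1) = p.1 (τ.time k.castSucc p.1),
            p.2.tail (τ.time k.castSucc p.1) _ h ∈ U p.1} ∧
      Measurable[τ.sigma k.castSucc] ε ∧
      (∀ᵐ ω ∂P, 0 < ε ω) ∧
      ∀ᵐ ω ∂P, ω.tail (τ.time k.castSucc ω) _ rfl ∈ U ω →
        τ.time k.castSucc ω < τ.time k.succ ω →
        ε ω ≤ (τ.time k.succ ω : ℝ) - (τ.time k.castSucc ω : ℝ)

/-! ### Portfolios -/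

/-- A portfolio: the adapted numbers of bonds and of shares. -/
structure Portfolio (P : Measure (PosPath 0 T s₀)) where
  bond : Set.Icc (0 : ℝ) T → PosPath 0 T s₀ → ℝ
  stock : Set.Icc (0 : ℝ) T → PosPath 0 T s₀ → ℝ
  bond_adapted : Adapted (usualFiltration P) bond
  stock_adapted : Adapted (usualFiltration P) stock

/-- The discounted value of a portfolio. -/
def Portfolio.value {P : Measure (PosPath 0 T s₀)} (Φ : Portfolio P) (t : Set.Icc (0 : ℝ) T)
    (ω : PosPath 0 T s₀) : ℝ :=
  Φ.bond t ω + Φ.stock t ω * ω t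

/-- The time `0`. -/
def startTime (hT : 0 < T) : Set.Icc (0 : ℝ) T := ⟨0, le_rfl, hT.le⟩

/-- The time `T`. -/
def endTime (hT : 0 < T) : Set.Icc (0 : ℝ) T := ⟨T, hT.le, le_rfl⟩

/-- A portfolio is an arbitrage if it costs nothing, its terminal value is almost surely
non-negative, and its terminal value is positive with positive probability. -/
def Portfolio.IsArbitrage {P : Measure (PosPath 0 T s₀)} (hT : 0 < T) (Φ : Portfolio P) : Prop :=
  (∀ᵐ ω ∂P, Φ.value (startTime hT) ω = 0) ∧
  (∀ᵐ ω ∂P, 0 ≤ Φ.value (endTime hT) ω) ∧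
  0 < P {ω | 0 < Φ.value (endTime hT) ω}

/-- The portfolio is simple with readjustment times `τ`: the stock position is
`∑_{k < n} φₖ 1_{(τₖ, τₖ₊₁]}` with `φₖ` measurable with respect to the σ-algebra of `τₖ`, and the
bond position is likewise constant on each `(τₖ, τₖ₊₁]`, on `[0, τ₀]` and on `(τₙ, T]`, where no
shares are held. -/
def Portfolio.IsSimpleAlong {P : Measure (PosPath 0 T s₀)} (hT : 0 < T) (Φ : Portfolio P)
    {n : ℕ} (τ : StoppingSeq P n) : Prop :=
  (∃ φ : Fin n → PosPath 0 T s₀ → ℝ,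
    (∀ k, Measurable[τ.sigma k.castSucc] (φ k)) ∧
    ∀ t ω, Φ.stock t ω =
      ∑ k : Fin n, (Set.Ioc (τ.time k.castSucc ω) (τ.time k.succ ω)).indicator
        (fun _ => φ k ω) t) ∧
  (∃ (ψ₀ : PosPath 0 T s₀ → ℝ) (ψ : Fin (n + 1) → PosPath 0 T s₀ → ℝ),
    Measurable[usualFiltration P (startTime hT)] ψ₀ ∧
    (∀ k, Measurable[τ.sigma k] (ψ k)) ∧
    ∀ t ω, Φ.bond t ω =
      (Set.Iic (τ.time 0 ω)).indicator (fun _ => ψ₀ ω) t +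
      ∑ k : Fin n, (Set.Ioc (τ.time k.castSucc ω) (τ.time k.succ ω)).indicator
        (fun _ => ψ k.castSucc ω) t +
      (Set.Ioi (τ.time (Fin.last n) ω)).indicator (fun _ => ψ (Fin.last n) ω) t)

/-- The portfolio is self-financing over the intervals between its readjustment times `τ`, and
over the last interval, from `τₙ` to `T`. -/
def Portfolio.IsSelfFinancingAlong {P : Measure (PosPath 0 T s₀)} (hT : 0 < T) (Φ : Portfolio P)
    {n : ℕ} (τ : StoppingSeq P n) : Prop :=
  (∀ k : Fin n, ∀ᵐ ω ∂P,
    Φ.value (τ.time k.succ ω) ω - Φ.value (τ.time k.castSucc ω) ω =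
      Φ.stock (τ.time k.succ ω) ω * (ω (τ.time k.succ ω) - ω (τ.time k.castSucc ω))) ∧
  ∀ᵐ ω ∂P,
    Φ.value (endTime hT) ω - Φ.value (τ.time (Fin.last n) ω) ω =
      Φ.stock (endTime hT) ω * (ω (endTime hT) - ω (τ.time (Fin.last n) ω))

/-- The class of (self-financing) delay-simple strategies. -/
def delaySimple (hT : 0 < T) (P : Measure (PosPath 0 T s₀)) : Set (Portfolio P) :=
  {Φ | ∃ (n : ℕ) (τ : StoppingSeq P n),
    τ.HasDelay ∧ Φ.IsSimpleAlong hT τ ∧ Φ.IsSelfFinancingAlong hT τ}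

/-- There is no arbitrage in the class `𝒜` of portfolios. -/
def NoArbitrageIn (hT : 0 < T) {P : Measure (PosPath 0 T s₀)} (𝒜 : Set (Portfolio P)) : Prop :=
  ∀ Φ ∈ 𝒜, ¬ Φ.IsArbitrage hT

end Basis

/-! ### The driving processes and the models -/

section Models

variable {E : Type*} [MeasurableSpace E]

/-- Fractional Brownian motion on `[0, T]` with Hurst index `H`: a centered Gaussian process which
starts from zero and has covariance `(t ^ (2H) + s ^ (2H) - |t - s| ^ (2H)) / 2`. -/
structure IsFBm {T : ℝ} (H : ℝ) (B : Set.Icc (0 : ℝ) T → E → ℝ) (Q : Measure E) : Prop where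
  gaussian : IsGaussianProcess B Q
  zero : ∀ t : Set.Icc (0 : ℝ) T, (t : ℝ) = 0 → ∀ᵐ e ∂Q, B t e = 0
  centered : ∀ t : Set.Icc (0 : ℝ) T, ∫ e, B t e ∂Q = 0
  covariance : ∀ t s : Set.Icc (0 : ℝ) T, cov[B t, B s; Q] =
    ((t : ℝ) ^ (2 * H) + (s : ℝ) ^ (2 * H) - |(t : ℝ) - s| ^ (2 * H)) / 2

/-- Brownian motion on `[0, T]`, the fractional Brownian motion with Hurst index `1 / 2`. -/
def IsBm {T : ℝ} (W : Set.Icc (0 : ℝ) T → E → ℝ) (Q : Measure E) : Prop :=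
  IsFBm (1 / 2) W Q

/-- `P` is the law, on the space of positive continuous paths from `s₀`, of the (continuous
version of the) process `S`. -/
def IsPathLaw {T s₀ : ℝ} (S : Set.Icc (0 : ℝ) T → E → ℝ) (Q : Measure E)
    (P : Measure (PosPath 0 T s₀)) : Prop :=
  ∃ X : E → PosPath 0 T s₀, HasLaw X P Q ∧ ∀ t, ∀ᵐ e ∂Q, X e t = S t e

end Models

end DelaySimple

end

noncomputable section

namespace DelaySimple

/-! In the logarithmic scale every model is `σ B + Y` with `B` a fractional Brownian motion
(`H = 1 / 2` included) and `Y` independent of `B`. By Cameron–Martin, the law of `B` is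
quasi-invariant under translations by the reproducing kernel Hilbert space of its covariance. This
space contains the smooth compactly supported functions which vanish at the origin: `B` has a
spectral density of order `|x| ^ (-1 - 2 * H)`, against which the Fourier transform of such a
function is square integrable. Conditioning on `Y` carries the quasi-invariance over to the price.
Smooth functions are uniformly dense, so almost every path can be continued after a given time
close to any prescribed function without entering a given null set.

A stopping time `τₖ₊₁` cannot distinguish two paths which coincide until after its value. So first
steer the path after `τₖ` into the open set of the delay property, which prevents a readjustment
before `τₖ + ε`, then, before that time, confine it to one side of its value at `τₖ`: the price
increment over `(τₖ, τₖ₊₁]` has a prescribed sign. If the terminal value is non-negative, then so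
are, by backward induction, all the intermediate values, and by forward induction all of them
vanish. -/

section Hilbert

theorem exists_inner_eq_of_sq_le {F V : Type*} [AddCommGroup F] [Module ℝ F]
    [NormedAddCommGroup V] [InnerProductSpace ℝ V] [CompleteSpace V]
    (A : F →ₗ[ℝ] V) (L : F →ₗ[ℝ] ℝ) {C : ℝ} (hL : ∀ c, L c ^ 2 ≤ C * ‖A c‖ ^ 2) :
    ∃ ξ : V, ∀ c, inner ℝ ξ (A c) = L c := by
  have hker : LinearMap.ker A ≤ LinearMap.ker L := fun c hc => by
    have := hL c
    rw [LinearMap.mem_ker.1 hc, norm_zero, zero_pow two_ne_zero, mul_zero] at this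
    exact sq_nonpos_iff _ |>.1 this
  let ℓ : LinearMap.range A →ₗ[ℝ] ℝ :=
    (LinearMap.ker A).liftQ L hker ∘ₗ A.quotKerEquivRange.symm.toLinearMap
  have hℓ : ∀ c, ℓ ⟨A c, c, rfl⟩ = L c := fun c => by
    have : A.quotKerEquivRange.symm ⟨A c, c, rfl⟩ = (LinearMap.ker A).mkQ c :=
      A.quotKerEquivRange_symm_apply_image c _
    simp [ℓ, this]
  have hbound : ∀ v, ‖ℓ v‖ ≤ √C * ‖v‖ := by
    rintro ⟨_, c, rfl⟩
    rw [hℓ]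
    refine (Real.abs_le_sqrt (hL c)).trans_eq ?_
    rw [Real.sqrt_mul' _ (sq_nonneg _), Real.sqrt_sq (norm_nonneg _)]
    rfl
  obtain ⟨g, hg, -⟩ := exists_extension_norm_eq _ (ℓ.mkContinuous _ hbound)
  refine ⟨(InnerProductSpace.toDual ℝ V).symm g, fun c => ?_⟩
  rw [InnerProductSpace.toDual_symm_apply, ← hℓ]
  exact hg ⟨A c, c, rfl⟩

end Hilbert

section Independence

variable {Ω G : Type*} [MeasurableSpace Ω] {P : Measure Ω} [IsFiniteMeasure P]
  [AddMonoid G] [MeasurableSpace G] [MeasurableAdd₂ G] {X Y Y' : Ω → G}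

theorem map_add_absolutelyContinuous_of_indepFun (hX : AEMeasurable X P) (hY : AEMeasurable Y P)
    (hY' : AEMeasurable Y' P) (hXY : IndepFun X Y P) (hXY' : IndepFun X Y' P)
    (h : P.map Y' ≪ P.map Y) : P.map (X + Y') ≪ P.map (X + Y) := by
  rw [hXY.map_add_eq_map_conv_map₀ hX hY, hXY'.map_add_eq_map_conv_map₀ hX hY']
  exact (Measure.AbsolutelyContinuous.rfl.prod h).map measurable_add

end Independence

section Gaussian

variable {Ω I : Type*} [MeasurableSpace Ω] {P : Measure Ω}

theorem coeFn_sum_smul (s : Finset I) (c : I → ℝ) (y : I → Lp ℝ 2 P) :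
    ⇑(∑ i ∈ s, c i • y i) =ᵐ[P] fun ω => ∑ i ∈ s, c i * y i ω := by
  have hsmul : ∀ᵐ ω ∂P, ∀ i ∈ s, (c i • y i : Lp ℝ 2 P) ω = c i * y i ω :=
    (ae_ball_iff s.countable_toSet).2 fun i _ => Lp.coeFn_smul _ _
  filter_upwards [Lp.coeFn_finsetSum s fun i => c i • y i, hsmul] with ω hsum hω
  rw [hsum, Finset.sum_apply]
  exact Finset.sum_congr rfl hω

theorem integral_sq_eq_norm_sq (u : Lp ℝ 2 P) : ∫ ω, u ω ^ 2 ∂P = ‖u‖ ^ 2 := by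
  rw [← real_inner_self_eq_norm_sq, L2.inner_def]
  simp only [real_inner_self_eq_norm_sq, Real.norm_eq_abs, sq_abs]

theorem aemeasurable_coeFn (u : Lp ℝ 2 P) : AEMeasurable u P :=
  (Lp.stronglyMeasurable u).measurable.aemeasurable

theorem continuous_charFun_map_coeFn [IsProbabilityMeasure P] (t : ℝ) :
    Continuous fun u : Lp ℝ 2 P => charFun (P.map u) t := by
  refine continuous_iff_seqContinuous.2 fun w u hw => ?_
  have h := (tendstoInMeasure_of_tendsto_Lp hw).tendstoInDistribution
    fun n => aemeasurable_coeFn (w n)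
  exact ProbabilityMeasure.tendsto_iff_tendsto_charFun.1 h.tendsto t

theorem map_eq_gaussianReal_iff_charFun [IsProbabilityMeasure P] (u : Lp ℝ 2 P) :
    P.map u = gaussianReal 0 (‖u‖₊ ^ 2) ↔
      ∀ t : ℝ, charFun (P.map u) t = Complex.exp (-(‖u‖ ^ 2 * t ^ 2 / 2 : ℝ)) := by
  have := Measure.isProbabilityMeasure_map (aemeasurable_coeFn u)
  have hchar (t : ℝ) : charFun (gaussianReal 0 (‖u‖₊ ^ 2)) t =
      Complex.exp (-(‖u‖ ^ 2 * t ^ 2 / 2 : ℝ)) := by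
    rw [charFun_gaussianReal]
    simp
  simp only [← hchar]
  exact ⟨fun h t => by rw [h], fun h => Measure.ext_of_charFun (funext h)⟩

theorem isClosed_setOf_map_eq_gaussianReal [IsProbabilityMeasure P] :
    IsClosed {u : Lp ℝ 2 P | P.map u = gaussianReal 0 (‖u‖₊ ^ 2)} := by
  simp only [map_eq_gaussianReal_iff_charFun, ofPred_forall]
  exact isClosed_iInter fun t => isClosed_eq (continuous_charFun_map_coeFn t) (by fun_prop)

/-- A Gaussian subspace of `L²`: all its elements are centered Gaussian variables, the variance
being then the square of the norm. -/
def IsGaussianSubspace (V : Submodule ℝ (Lp ℝ 2 P)) : Prop :=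
  ∀ u ∈ V, P.map u = gaussianReal 0 (‖u‖₊ ^ 2)

theorem isGaussianSubspace_span {y : I → Lp ℝ 2 P}
    (hy : IsGaussianProcess (fun i => ⇑(y i)) P) (hy0 : ∀ i, ∫ ω, y i ω ∂P = 0) :
    IsGaussianSubspace (Submodule.span ℝ (range y)) := by
  intro u hu
  obtain ⟨c, rfl⟩ := Finsupp.mem_span_range_iff_exists_finsupp.1 hu
  set u := c.sum fun i a => a • y i
  have hu : ⇑u =ᵐ[P] fun ω => ∑ i ∈ c.support, c i * y i ω := coeFn_sum_smul _ _ _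
  have hgauss : HasGaussianLaw u P :=
    ((hy.smul c).hasGaussianLaw_fun_sum (I := c.support)).congr hu.symm
  have hmean : ∫ ω, u ω ∂P = 0 := by
    rw [integral_congr_ae hu, integral_finsetSum _ fun i _ =>
      (hy.hasGaussianLaw_eval i).integrable.const_mul (c i)]
    simp only [integral_const_mul, hy0, mul_zero, Finset.sum_const_zero]
  rw [hgauss.map_eq_gaussianReal, hmean,
    variance_of_integral_eq_zero hgauss.aemeasurable hmean, integral_sq_eq_norm_sq]
  congr 1
  ext
  simp

namespace IsGaussianSubspace

variable {V : Submodule ℝ (Lp ℝ 2 P)}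

theorem topologicalClosure [IsProbabilityMeasure P] (hV : IsGaussianSubspace V) :
    IsGaussianSubspace V.topologicalClosure :=
  closure_minimal hV isClosed_setOf_map_eq_gaussianReal

theorem integral_eq_zero (hV : IsGaussianSubspace V) {u : Lp ℝ 2 P} (hu : u ∈ V) :
    ∫ ω, u ω ∂P = 0 := by
  have h := integral_map (aemeasurable_coeFn u) (f := id) aestronglyMeasurable_id
  rw [hV u hu] at h
  simpa using h.symm

theorem isGaussianProcess (hV : IsGaussianSubspace V) :
    IsGaussianProcess (fun (u : V) => ⇑(u : Lp ℝ 2 P)) P := by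
  classical
  refine ⟨fun F => ⟨isGaussian_of_map_eq_gaussianReal fun L => ?_⟩⟩
  set X : Ω → F → ℝ := fun ω => F.restrict fun u : V => (u : Lp ℝ 2 P) ω
  have hX : AEMeasurable X P := aemeasurable_pi_lambda _ fun u => aemeasurable_coeFn _
  set w : V := ∑ u : F, L (Pi.single u 1) • (u : V)
  have hw : L ∘ X =ᵐ[P] ⇑(w : Lp ℝ 2 P) := by
    have hcoe : (w : Lp ℝ 2 P) = ∑ u : F, L (Pi.single u 1) • ((u : V) : Lp ℝ 2 P) := by simp [w]
    rw [hcoe]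
    refine .trans (.of_eq (funext fun ω => ?_)) (coeFn_sum_smul _ _ _).symm
    conv_lhs => rw [Function.comp_apply, ← Finset.univ_sum_single (X ω), map_sum]
    refine Finset.sum_congr rfl fun u _ => ?_
    rw [← mul_one (X ω u), ← smul_eq_mul, Pi.single_smul, map_smul, smul_eq_mul, mul_comm]
    rfl
  refine ⟨0, ‖(w : Lp ℝ 2 P)‖₊ ^ 2, ?_⟩
  rw [AEMeasurable.map_map_of_aemeasurable L.continuous.aemeasurable hX, Measure.map_congr hw,
    hV w w.2]

theorem indepFun_of_inner_eq_zero (hV : IsGaussianSubspace V) {z : I → Lp ℝ 2 P} {ξ : Lp ℝ 2 P}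
    (hz : ∀ i, z i ∈ V) (hξ : ξ ∈ V) (hzξ : ∀ i, inner ℝ (z i) ξ = 0) :
    IndepFun (fun ω i => z i ω) ξ P := by
  have hjoint : IsGaussianProcess (Sum.elim (fun i => ⇑(z i)) fun _ : Unit => ⇑ξ) P := by
    have h := hV.isGaussianProcess.comp_right
      (Sum.elim (fun i => ⟨z i, hz i⟩) fun _ : Unit => ⟨ξ, hξ⟩)
    exact h.congr (by rintro (_ | _) <;> rfl)
  have := hjoint.isProbabilityMeasure
  have hcov (i : I) : cov[z i, ξ; P] = 0 := by
    rw [covariance_eq_sub (Lp.memLp _) (Lp.memLp _), hV.integral_eq_zero hξ, mul_zero, sub_zero,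
      ← hzξ i, L2.inner_def]
    simp only [Pi.mul_apply, RCLike.inner_apply, conj_trivial, mul_comm]
  exact (hjoint.indepFun_of_covariance_eq_zero (fun i => aemeasurable_coeFn _)
    (fun _ => aemeasurable_coeFn _) fun i _ => hcov i).comp measurable_id (measurable_pi_apply ())

theorem map_add_const_absolutelyContinuous (hV : IsGaussianSubspace V) {ξ : Lp ℝ 2 P}
    (hξ : ξ ∈ V) (hξ0 : ξ ≠ 0) (a : ℝ) : P.map (fun ω => ξ ω + a) ≪ P.map ξ := by
  have hvar : ‖ξ‖₊ ^ 2 ≠ 0 := by simpa using hξ0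
  have hmap : P.map (fun ω => ξ ω + a) = gaussianReal (0 + a) (‖ξ‖₊ ^ 2) := by
    rw [← gaussianReal_map_add_const, ← hV ξ hξ,
      AEMeasurable.map_map_of_aemeasurable (by fun_prop) (aemeasurable_coeFn ξ)]
    rfl
  rw [hmap, hV ξ hξ]
  exact (gaussianReal_absolutelyContinuous _ hvar).trans
    (gaussianReal_absolutelyContinuous' _ hvar)

/- With `k i = ⟪ξ, y i⟫ / ‖ξ‖²` the process splits into `z i = y i - k i • ξ`, which is orthogonal
to `ξ` and hence independent of it, and `k i • ξ`; only the latter is translated. -/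
theorem map_add_inner_absolutelyContinuous [Countable I] (hV : IsGaussianSubspace V)
    {y : I → Lp ℝ 2 P} {ξ : Lp ℝ 2 P} (hy : ∀ i, y i ∈ V) (hξ : ξ ∈ V) :
    P.map (fun ω i => y i ω + inner ℝ ξ (y i)) ≪ P.map fun ω i => y i ω := by
  have := hV.isGaussianProcess.isProbabilityMeasure
  obtain rfl | hξ0 := eq_or_ne ξ 0
  · simpa only [inner_zero_left, add_zero] using .rfl
  have hnorm : ‖ξ‖ ^ 2 ≠ 0 := by simpa using hξ0
  set k : I → ℝ := fun i => inner ℝ ξ (y i) / ‖ξ‖ ^ 2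
  set z : I → Lp ℝ 2 P := fun i => y i - k i • ξ
  have hzξ (i : I) : inner ℝ (z i) ξ = 0 := by
    rw [inner_sub_left, real_inner_smul_left, real_inner_self_eq_norm_sq,
      div_mul_cancel₀ _ hnorm, real_inner_comm, sub_self]
  have hsplit : ∀ᵐ ω ∂P, ∀ i, y i ω = z i ω + k i * ξ ω := by
    refine ae_all_iff.2 fun i => ?_
    filter_upwards [Lp.coeFn_sub (y i) (k i • ξ), Lp.coeFn_smul (k i) ξ] with ω hsub hsmul
    rw [hsub, Pi.sub_apply, hsmul, Pi.smul_apply, smul_eq_mul, sub_add_cancel]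
  set line : ℝ → I → ℝ := fun r i => k i * r
  have hline : Measurable line := by fun_prop
  have hz : AEMeasurable (fun ω i => z i ω) P :=
    aemeasurable_pi_lambda _ fun i => aemeasurable_coeFn _
  have hξm : AEMeasurable ξ P := aemeasurable_coeFn _
  have hξm' : AEMeasurable (fun ω => ξ ω + ‖ξ‖ ^ 2) P := hξm.add_const _
  have hind : IndepFun (fun ω i => z i ω) ξ P :=
    hV.indepFun_of_inner_eq_zero (fun i => V.sub_mem (hy i) (V.smul_mem _ hξ)) hξ hzξ
  have hac : P.map (line ∘ fun ω => ξ ω + ‖ξ‖ ^ 2) ≪ P.map (line ∘ ξ) := by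
    rw [← AEMeasurable.map_map_of_aemeasurable hline.aemeasurable hξm',
      ← AEMeasurable.map_map_of_aemeasurable hline.aemeasurable hξm]
    exact (hV.map_add_const_absolutelyContinuous hξ hξ0 _).map hline
  convert map_add_absolutelyContinuous_of_indepFun hz (hline.comp_aemeasurable hξm)
    (hline.comp_aemeasurable hξm') (hind.comp measurable_id hline)
    (hind.comp measurable_id (hline.comp (measurable_add_const _))) hac using 1 <;>
  · refine Measure.map_congr ?_
    filter_upwards [hsplit] with ω hω
    ext i
    simp only [hω, Pi.add_apply, line, k, Function.comp_apply, mul_add, div_mul_cancel₀ _ hnorm,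
      add_assoc]

end IsGaussianSubspace

/- The hypothesis `hC` says that `h` belongs to the reproducing kernel Hilbert space of the
covariance, so this is the qualitative half of the Cameron–Martin theorem. -/
theorem map_add_absolutelyContinuous_of_sq_le [Countable I] {x : I → Ω → ℝ}
    (hx : IsGaussianProcess x P) (hx0 : ∀ i, ∫ ω, x i ω ∂P = 0) (h : I → ℝ) {C : ℝ}
    (hC : ∀ c : I →₀ ℝ, (c.sum fun i a => a * h i) ^ 2 ≤
      C * ∫ ω, (c.sum fun i a => a * x i ω) ^ 2 ∂P) :
    P.map (fun ω i => x i ω + h i) ≪ P.map fun ω i => x i ω := by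
  have := hx.isProbabilityMeasure
  have hx2 (i : I) : MemLp (x i) 2 P := (hx.hasGaussianLaw_eval i).memLp_two
  set y : I → Lp ℝ 2 P := fun i => (hx2 i).toLp (x i)
  have hyx : ∀ᵐ ω ∂P, ∀ i, y i ω = x i ω := ae_all_iff.2 fun i => (hx2 i).coeFn_toLp
  set V := (Submodule.span ℝ (range y)).topologicalClosure
  have hV : IsGaussianSubspace V := (isGaussianSubspace_span
    (hx.congr fun i => (hx2 i).coeFn_toLp.symm) fun i =>
      (integral_congr_ae (hx2 i).coeFn_toLp).trans (hx0 i)).topologicalClosure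
  set y' : I → V := fun i =>
    ⟨y i, Submodule.le_topologicalClosure _ (Submodule.subset_span ⟨i, rfl⟩)⟩
  have hnorm (c : I →₀ ℝ) : ‖Finsupp.linearCombination ℝ y' c‖ ^ 2 =
      ∫ ω, (c.sum fun i a => a * x i ω) ^ 2 ∂P := by
    have hcoe : ((Finsupp.linearCombination ℝ y' c : V) : Lp ℝ 2 P) =
        ∑ i ∈ c.support, c i • y i := by
      simp [Finsupp.linearCombination_apply, Finsupp.sum, y']
    rw [Submodule.coe_norm, ← integral_sq_eq_norm_sq, hcoe]
    refine integral_congr_ae ?_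
    filter_upwards [coeFn_sum_smul c.support c y, hyx] with ω hsum hω
    simp only [hsum, hω, Finsupp.sum]
  obtain ⟨ξ, hξ⟩ := exists_inner_eq_of_sq_le (Finsupp.linearCombination ℝ y')
    (Finsupp.linearCombination ℝ h) (C := C) fun c => by
      rw [hnorm]
      simpa only [Finsupp.linearCombination_apply, smul_eq_mul] using hC c
  have hξh (i : I) : inner ℝ (ξ : Lp ℝ 2 P) (y i) = h i := by
    simpa [y'] using hξ (Finsupp.single i 1)
  convert hV.map_add_inner_absolutelyContinuous (fun i => (y' i).2) ξ.2 using 1 <;>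
  · refine Measure.map_congr ?_
    filter_upwards [hyx] with ω hω
    ext i
    simp only [hξh, y', hω]

end Gaussian

section Fourier

open scoped FourierTransform SchwartzMap

/-- The covariance function of fractional Brownian motion with Hurst index `H`, on the whole real
line. -/
def fBmKernel (H s t : ℝ) : ℝ := (|s| ^ (2 * H) + |t| ^ (2 * H) - |s - t| ^ (2 * H)) / 2

/-- Up to a constant factor, the spectral density at the frequency `x` of the increments over a time
lag `s` of fractional Brownian motion with Hurst index `H`. -/
def lagSpectralDensity (H s x : ℝ) : ℝ :=
  (1 - Real.cos (2 * Real.pi * (s * x))) / |x| ^ (1 + 2 * H)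

/-- The Fourier transform of the finite measure `∑ i ∈ F, c i • (δ_{s i} - δ_0)`. -/
def centeredTrigSum {ι : Type*} (F : Finset ι) (c s : ι → ℝ) (x : ℝ) : ℂ :=
  ∑ i ∈ F, (c i : ℂ) * (Complex.exp ((2 * Real.pi * (s i * x) : ℝ) * Complex.I) - 1)

variable {H : ℝ}

theorem lagSpectralDensity_nonneg (H s x : ℝ) : 0 ≤ lagSpectralDensity H s x :=
  div_nonneg (sub_nonneg.2 (Real.cos_le_one _)) (by positivity)

theorem measurable_lagSpectralDensity (H s : ℝ) : Measurable (lagSpectralDensity H s) := by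
  unfold lagSpectralDensity
  fun_prop

theorem lagSpectralDensity_zero (H x : ℝ) : lagSpectralDensity H 0 x = 0 := by
  simp [lagSpectralDensity]

theorem lagSpectralDensity_neg (H s x : ℝ) :
    lagSpectralDensity H s (-x) = lagSpectralDensity H s x := by
  simp [lagSpectralDensity]

theorem lagSpectralDensity_eq_mul {s : ℝ} (hs : s ≠ 0) (x : ℝ) :
    lagSpectralDensity H s x = |s| ^ (1 + 2 * H) * lagSpectralDensity H 1 (s * x) := by
  have : |s| ^ (1 + 2 * H) ≠ 0 := (Real.rpow_pos_of_pos (abs_pos.2 hs) _).ne'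
  rw [lagSpectralDensity, lagSpectralDensity, one_mul, abs_mul,
    Real.mul_rpow (abs_nonneg _) (abs_nonneg _)]
  field_simp

theorem lagSpectralDensity_one_le_rpow {x : ℝ} (hx : 0 < x) :
    lagSpectralDensity H 1 x ≤ (2 * Real.pi) ^ 2 / 2 * x ^ (1 - 2 * H) := by
  have hcos := Real.one_sub_sq_div_two_le_cos (x := 2 * Real.pi * x)
  have hsplit : x ^ (1 - 2 * H) = x ^ 2 / x ^ (1 + 2 * H) := by
    rw [← Real.rpow_natCast, ← Real.rpow_sub hx]
    congr 1
    push_cast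
    ring
  rw [lagSpectralDensity, one_mul, abs_of_pos hx, hsplit, ← mul_div_assoc]
  gcongr
  linarith

theorem lagSpectralDensity_le_two_mul_rpow (s : ℝ) {x : ℝ} (hx : 0 < x) :
    lagSpectralDensity H s x ≤ 2 * x ^ (-(1 + 2 * H)) := by
  rw [lagSpectralDensity, abs_of_pos hx, Real.rpow_neg hx.le, ← div_eq_mul_inv]
  gcongr
  linarith [Real.neg_one_le_cos (2 * Real.pi * (s * x))]

theorem integrable_lagSpectralDensity (hH : 0 < H) (hH1 : H < 1) (s : ℝ) :
    Integrable (lagSpectralDensity H s) := by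
  have hpos : IntegrableOn (lagSpectralDensity H 1) (Ioi 0) := by
    rw [← Ioc_union_Ioi_eq_Ioi zero_le_one]
    have hnear : IntegrableOn (fun x : ℝ => (2 * Real.pi) ^ 2 / 2 * x ^ (1 - 2 * H)) (Ioc 0 1) :=
      ((intervalIntegrable_iff_integrableOn_Ioc_of_le zero_le_one).1
        (intervalIntegral.intervalIntegrable_rpow' (by linarith))).const_mul _
    have hfar : IntegrableOn (fun x : ℝ => 2 * x ^ (-(1 + 2 * H))) (Ioi 1) :=
      (integrableOn_Ioi_rpow_of_lt (by linarith) one_pos).const_mul _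
    refine .union (hnear.mono' (measurable_lagSpectralDensity H 1).aestronglyMeasurable ?_)
      (hfar.mono' (measurable_lagSpectralDensity H 1).aestronglyMeasurable ?_)
    · filter_upwards [ae_restrict_mem measurableSet_Ioc] with x hx
      rw [Real.norm_of_nonneg (lagSpectralDensity_nonneg _ _ _)]
      exact lagSpectralDensity_one_le_rpow hx.1
    · filter_upwards [ae_restrict_mem measurableSet_Ioi] with x hx
      rw [Real.norm_of_nonneg (lagSpectralDensity_nonneg _ _ _)]
      exact lagSpectralDensity_le_two_mul_rpow 1 (one_pos.trans hx)
  have hone : Integrable (lagSpectralDensity H 1) := by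
    rw [← integrableOn_univ, ← Iic_union_Ioi (a := (0 : ℝ))]
    refine .union ?_ hpos
    have hneg := (integrableOn_Ici_iff_integrableOn_Ioi (μ := volume)).2 hpos
    rw [← neg_zero] at hneg
    simpa only [lagSpectralDensity_neg] using hneg.comp_neg_Iic
  obtain rfl | hs := eq_or_ne s 0
  · simp only [show lagSpectralDensity H 0 = 0 from funext (lagSpectralDensity_zero H)]
    exact integrable_zero _ _ _
  · rw [show lagSpectralDensity H s = _ from funext (lagSpectralDensity_eq_mul hs)]
    exact (hone.comp_mul_left' hs).const_mul _

theorem integral_lagSpectralDensity (hH : 0 < H) (s : ℝ) :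
    ∫ x, lagSpectralDensity H s x = |s| ^ (2 * H) * ∫ x, lagSpectralDensity H 1 x := by
  obtain rfl | hs := eq_or_ne s 0
  · simp [lagSpectralDensity_zero, Real.zero_rpow (by positivity : 2 * H ≠ 0)]
  · simp only [lagSpectralDensity_eq_mul hs, integral_const_mul]
    rw [Measure.integral_comp_mul_left (lagSpectralDensity H 1) s, smul_eq_mul, ← mul_assoc,
      abs_inv, Real.rpow_add (abs_pos.2 hs), Real.rpow_one]
    field_simp

theorem integrable_lagSpectralDensity_add_sub (hH : 0 < H) (hH1 : H < 1) (s t : ℝ) :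
    Integrable fun x => lagSpectralDensity H s x + lagSpectralDensity H t x -
      lagSpectralDensity H (s - t) x :=
  ((integrable_lagSpectralDensity hH hH1 s).add (integrable_lagSpectralDensity hH hH1 t)).sub
    (integrable_lagSpectralDensity hH hH1 _)

theorem integral_lagSpectralDensity_add_sub (hH : 0 < H) (hH1 : H < 1) (s t : ℝ) :
    ∫ x, (lagSpectralDensity H s x + lagSpectralDensity H t x - lagSpectralDensity H (s - t) x) =
      (2 * ∫ x, lagSpectralDensity H 1 x) * fBmKernel H s t := by
  have hint := integrable_lagSpectralDensity hH hH1
  have hadd : Integrable fun x => lagSpectralDensity H s x + lagSpectralDensity H t x :=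
    (hint s).add (hint t)
  rw [integral_sub hadd (hint _), integral_add (hint s) (hint t), integral_lagSpectralDensity hH s,
    integral_lagSpectralDensity hH t, integral_lagSpectralDensity hH (s - t), fBmKernel]
  ring

section TrigSum

variable {ι : Type*} (F : Finset ι) (c s : ι → ℝ)

theorem continuous_centeredTrigSum : Continuous (centeredTrigSum F c s) := by
  unfold centeredTrigSum
  fun_prop

theorem norm_sq_centeredTrigSum_div (x : ℝ) :
    ‖centeredTrigSum F c s x‖ ^ 2 / |x| ^ (1 + 2 * H) =
      ∑ i ∈ F, ∑ j ∈ F, c i * c j * (lagSpectralDensity H (s i) x + lagSpectralDensity H (s j) x -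
        lagSpectralDensity H (s i - s j) x) := by
  rw [centeredTrigSum, ← Complex.normSq_eq_norm_sq, Complex.normSq_apply, Complex.re_sum,
    Complex.im_sum]
  simp only [Complex.re_ofReal_mul, Complex.im_ofReal_mul, Complex.sub_re, Complex.sub_im,
    Complex.exp_ofReal_mul_I_re, Complex.exp_ofReal_mul_I_im, Complex.one_re, Complex.one_im,
    lagSpectralDensity]
  simp only [Finset.sum_mul_sum, ← Finset.sum_add_distrib, Finset.sum_div]
  refine Finset.sum_congr rfl fun i _ => Finset.sum_congr rfl fun j _ => ?_
  have hsub : 2 * Real.pi * ((s i - s j) * x) =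
      2 * Real.pi * (s i * x) - 2 * Real.pi * (s j * x) := by ring
  rw [hsub, Real.cos_sub]
  ring

theorem integrable_norm_sq_centeredTrigSum_div (hH : 0 < H) (hH1 : H < 1) :
    Integrable fun x => ‖centeredTrigSum F c s x‖ ^ 2 / |x| ^ (1 + 2 * H) := by
  simp only [norm_sq_centeredTrigSum_div]
  exact integrable_finsetSum _ fun i _ => integrable_finsetSum _ fun j _ =>
    (integrable_lagSpectralDensity_add_sub hH hH1 _ _).const_mul _

theorem integral_norm_sq_centeredTrigSum_div (hH : 0 < H) (hH1 : H < 1) :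
    ∫ x, ‖centeredTrigSum F c s x‖ ^ 2 / |x| ^ (1 + 2 * H) =
      (2 * ∫ x, lagSpectralDensity H 1 x) *
        ∑ i ∈ F, ∑ j ∈ F, c i * c j * fBmKernel H (s i) (s j) := by
  have hint (i j : ι) := (integrable_lagSpectralDensity_add_sub hH hH1 (s i) (s j)).const_mul
    (c i * c j)
  simp only [norm_sq_centeredTrigSum_div]
  rw [integral_finsetSum _ fun i _ => integrable_finsetSum _ fun j _ => hint i j, Finset.mul_sum]
  refine Finset.sum_congr rfl fun i _ => ?_
  rw [integral_finsetSum _ fun j _ => hint i j, Finset.mul_sum]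
  refine Finset.sum_congr rfl fun j _ => ?_
  rw [integral_const_mul, integral_lagSpectralDensity_add_sub hH hH1, mul_left_comm]

theorem sum_mul_eq_integral_centeredTrigSum (f : 𝓢(ℝ, ℂ)) (hf : f 0 = 0) :
    ∑ i ∈ F, (c i : ℂ) * f (s i) = ∫ x, centeredTrigSum F c s x * (𝓕 f : 𝓢(ℝ, ℂ)) x := by
  set G : 𝓢(ℝ, ℂ) := 𝓕 f
  have hinv (t : ℝ) :
      f t = ∫ x, Complex.exp ((2 * Real.pi * (t * x) : ℝ) * Complex.I) * G x := by
    have hG : 𝓕⁻ G = f := FourierTransform.fourierInv_fourier_eq f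
    rw [← hG, SchwartzMap.fourierInv_coe, Real.fourierInv_eq']
    simp [mul_comm]
  have hF0 : ∫ x, G x = 0 := by simpa [hf] using (hinv 0).symm
  have hint : Integrable G := G.integrable
  have hexp (t : ℝ) : Integrable fun x : ℝ =>
      Complex.exp ((2 * Real.pi * (t * x) : ℝ) * Complex.I) * G x :=
    hint.bdd_mul (c := 1) (Continuous.aestronglyMeasurable (by fun_prop))
      (.of_forall fun x => by rw [Complex.norm_exp_ofReal_mul_I])
  have hterm (i : ι) : Integrable fun x =>
      (c i : ℂ) * (Complex.exp ((2 * Real.pi * (s i * x) : ℝ) * Complex.I) * G x - G x) :=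
    ((hexp (s i)).sub hint).const_mul _
  have hexpand (x : ℝ) : centeredTrigSum F c s x * G x = ∑ i ∈ F,
      (c i : ℂ) * (Complex.exp ((2 * Real.pi * (s i * x) : ℝ) * Complex.I) * G x - G x) := by
    rw [centeredTrigSum, Finset.sum_mul]
    exact Finset.sum_congr rfl fun i _ => by ring
  simp only [hexpand]
  rw [integral_finsetSum _ fun i _ => hterm i]
  refine Finset.sum_congr rfl fun i _ => ?_
  rw [integral_const_mul, integral_sub (hexp _) hint, hF0, sub_zero, hinv]

end TrigSum

theorem abs_rpow_le_one_add_pow {p : ℝ} (hp : 0 ≤ p) (x : ℝ) :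
    |x| ^ p ≤ 1 + |x| ^ ⌈p⌉₊ := by
  obtain h | h := le_total |x| 1
  · exact (Real.rpow_le_one (abs_nonneg x) h hp).trans (le_add_of_nonneg_right (by positivity))
  · have := Real.rpow_le_rpow_of_exponent_le h (Nat.le_ceil p)
    rw [Real.rpow_natCast] at this
    exact this.trans (le_add_of_nonneg_left zero_le_one)

theorem integrable_norm_sq_mul_abs_rpow (G : 𝓢(ℝ, ℂ)) {p : ℝ} (hp : 0 ≤ p) :
    Integrable fun x => ‖G x‖ ^ 2 * |x| ^ p := by
  obtain ⟨M, -, hM⟩ := G.decay 0 0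
  simp only [pow_zero, one_mul, norm_iteratedFDeriv_zero] at hM
  have hmeas : Measurable fun x => ‖G x‖ ^ 2 * |x| ^ p := by
    have := G.continuous.measurable
    fun_prop
  refine (((G.integrable_pow_mul volume 0).add
    (G.integrable_pow_mul volume ⌈p⌉₊)).const_mul M).mono' hmeas.aestronglyMeasurable
    (.of_forall fun x => ?_)
  rw [Real.norm_of_nonneg (by positivity)]
  calc ‖G x‖ ^ 2 * |x| ^ p ≤ (M * ‖G x‖) * (1 + |x| ^ ⌈p⌉₊) := by
        rw [sq]
        exact mul_le_mul (mul_le_mul_of_nonneg_right (hM x) (norm_nonneg _))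
          (abs_rpow_le_one_add_pow hp x) (by positivity)
          (mul_nonneg ((norm_nonneg _).trans (hM x)) (norm_nonneg _))
    _ = _ := by
        simp only [Pi.add_apply, pow_zero, Real.norm_eq_abs]
        ring

theorem norm_integral_mul_sq_le {α : Type*} [MeasurableSpace α] {μ : Measure α} {u v : α → ℂ}
    {w : α → ℝ} (hu : AEStronglyMeasurable u μ) (hv : AEStronglyMeasurable v μ)
    (hwm : AEMeasurable w μ) (hw : ∀ᵐ x ∂μ, 0 < w x) (hu2 : Integrable (fun x => ‖u x‖ ^ 2 / w x) μ)
    (hv2 : Integrable (fun x => ‖v x‖ ^ 2 * w x) μ) :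
    ‖∫ x, u x * v x ∂μ‖ ^ 2 ≤ (∫ x, ‖u x‖ ^ 2 / w x ∂μ) * ∫ x, ‖v x‖ ^ 2 * w x ∂μ := by
  set a : α → ℝ := fun x => ‖u x‖ / √(w x)
  set b : α → ℝ := fun x => ‖v x‖ * √(w x)
  have ha2 : (fun x => a x ^ 2) =ᵐ[μ] fun x => ‖u x‖ ^ 2 / w x := by
    filter_upwards [hw] with x hx
    rw [div_pow, Real.sq_sqrt hx.le]
  have hb2 : (fun x => b x ^ 2) =ᵐ[μ] fun x => ‖v x‖ ^ 2 * w x := by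
    filter_upwards [hw] with x hx
    rw [mul_pow, Real.sq_sqrt hx.le]
  have ha : MemLp a 2 μ := (memLp_two_iff_integrable_sq
    (hu.norm.aemeasurable.div hwm.sqrt).aestronglyMeasurable).2 (hu2.congr ha2.symm)
  have hb : MemLp b 2 μ := (memLp_two_iff_integrable_sq
    (hv.norm.aemeasurable.mul hwm.sqrt).aestronglyMeasurable).2 (hv2.congr hb2.symm)
  have hab : ‖∫ x, u x * v x ∂μ‖ ≤ ∫ x, a x * b x ∂μ := by
    refine (norm_integral_le_integral_norm _).trans_eq (integral_congr_ae ?_)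
    filter_upwards [hw] with x hx
    simp only [a, b, norm_mul]
    field_simp [(Real.sqrt_pos.2 hx).ne']
  have hCS := integral_mul_le_Lp_mul_Lq_of_nonneg Real.HolderConjugate.two_two
    (.of_forall fun x => by positivity : 0 ≤ᵐ[μ] a) (.of_forall fun x => by positivity : 0 ≤ᵐ[μ] b)
    (by simpa using ha) (by simpa using hb)
  simp only [Real.rpow_two, ← Real.sqrt_eq_rpow] at hCS
  rw [← integral_congr_ae ha2, ← integral_congr_ae hb2]
  calc ‖∫ x, u x * v x ∂μ‖ ^ 2 ≤ (√(∫ x, a x ^ 2 ∂μ) * √(∫ x, b x ^ 2 ∂μ)) ^ 2 := by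
        gcongr
        exact hab.trans hCS
    _ = _ := by
        rw [mul_pow, Real.sq_sqrt (integral_nonneg fun x => sq_nonneg _),
          Real.sq_sqrt (integral_nonneg fun x => sq_nonneg _)]

/- A Schwartz function which vanishes at the origin belongs to the reproducing kernel Hilbert space
of fractional Brownian motion, by Cauchy–Schwarz in the harmonizable representation. -/
theorem exists_norm_sq_sum_le_fBmKernel (hH : 0 < H) (hH1 : H < 1) (f : 𝓢(ℝ, ℂ)) (hf : f 0 = 0) :
    ∃ C, ∀ {ι : Type*} (F : Finset ι) (c s : ι → ℝ), ‖∑ i ∈ F, (c i : ℂ) * f (s i)‖ ^ 2 ≤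
      C * ∑ i ∈ F, ∑ j ∈ F, c i * c j * fBmKernel H (s i) (s j) := by
  have hw : ∀ᵐ x : ℝ, 0 < |x| ^ (1 + 2 * H) := by
    filter_upwards [compl_mem_ae_iff.2 (measure_singleton (0 : ℝ))] with x hx
    exact Real.rpow_pos_of_pos (abs_pos.2 hx) _
  refine ⟨(∫ x, ‖(𝓕 f : 𝓢(ℝ, ℂ)) x‖ ^ 2 * |x| ^ (1 + 2 * H)) *
    (2 * ∫ x, lagSpectralDensity H 1 x), fun F c s => ?_⟩
  rw [sum_mul_eq_integral_centeredTrigSum F c s f hf, mul_assoc,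
    ← integral_norm_sq_centeredTrigSum_div F c s hH hH1, mul_comm]
  exact norm_integral_mul_sq_le (continuous_centeredTrigSum F c s).aestronglyMeasurable
    (𝓕 f : 𝓢(ℝ, ℂ)).continuous.aestronglyMeasurable (by fun_prop) hw
    (integrable_norm_sq_centeredTrigSum_div F c s hH hH1)
    (integrable_norm_sq_mul_abs_rpow _ (by positivity))

end Fourier

section Shift

variable {T s₀ : ℝ}

/-- The space `C₀([0, T])` of continuous functions on `[0, T]` which vanish at the origin. -/
abbrev NullStart (T : ℝ) : Type :=
  {g : C(Set.Icc (0 : ℝ) T, ℝ) // ∀ t : Set.Icc (0 : ℝ) T, (t : ℝ) = 0 → g t = 0}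

/-- The path `ω exp(g)`, the translate of `ω` by `g` in the logarithmic scale. -/
def PosPath.shift (ω : PosPath 0 T s₀) (g : NullStart T) : PosPath 0 T s₀ :=
  ⟨⟨fun t => ω t * Real.exp (g.1 t),
      ω.1.continuous.mul (Real.continuous_exp.comp g.1.continuous)⟩,
    fun t => mul_pos (ω.2.1 t) (Real.exp_pos _), fun t ht => by
      change ω t * Real.exp (g.1 t) = s₀
      rw [g.2 t ht, Real.exp_zero, mul_one, ω.2.2 t ht]⟩

theorem PosPath.shift_apply (ω : PosPath 0 T s₀) (g : NullStart T) (t : Set.Icc (0 : ℝ) T) :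
    ω.shift g t = ω t * Real.exp (g.1 t) := rfl

theorem PosPath.log_shift (ω : PosPath 0 T s₀) (g : NullStart T) (t : Set.Icc (0 : ℝ) T) :
    Real.log (ω.shift g t) = Real.log (ω t) + g.1 t := by
  rw [shift_apply, Real.log_mul (ω.2.1 t).ne' (Real.exp_pos _).ne', Real.log_exp]

theorem PosPath.measurable_eval (t : Set.Icc (0 : ℝ) T) :
    Measurable fun ω : PosPath 0 T s₀ => ω t :=
  Measurable.of_comap_le (le_iSup (fun t : Set.Icc (0 : ℝ) T =>
    MeasurableSpace.comap (fun f : PosPath 0 T s₀ => f t) inferInstance) t)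

theorem PosPath.cylinderSigma_le_iff {m : MeasurableSpace (PosPath 0 T s₀)} :
    PosPath.cylinderSigma 0 T s₀ ≤ m ↔ ∀ t, Measurable[m] fun ω : PosPath 0 T s₀ => ω t := by
  simp only [PosPath.cylinderSigma, iSup_le_iff, measurable_iff_comap_le]

theorem PosPath.measurable_shift (g : NullStart T) :
    Measurable fun ω : PosPath 0 T s₀ => ω.shift g := by
  rw [measurable_iff_le_map, PosPath.cylinderSigma_le_iff]
  exact fun t => (PosPath.measurable_eval t).mul_const (Real.exp (g.1 t))

theorem PosPath.cylinderSigma_le_comap_log {D : Set (Set.Icc (0 : ℝ) T)} (hD : Dense D) :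
    PosPath.cylinderSigma 0 T s₀ ≤
      MeasurableSpace.comap (fun ω (t : D) => Real.log (ω t)) MeasurableSpace.pi := by
  set L : PosPath 0 T s₀ → D → ℝ := fun ω t => Real.log (ω t)
  refine PosPath.cylinderSigma_le_iff.2 fun t => ?_
  obtain ⟨u, hu, hut⟩ := mem_closure_iff_seq_limit.1 (hD t)
  have heval (n : ℕ) : Measurable[MeasurableSpace.comap L MeasurableSpace.pi]
      fun ω : PosPath 0 T s₀ => ω (u n) := by
    have hexp : (fun ω : PosPath 0 T s₀ => ω (u n)) = fun ω => Real.exp (L ω ⟨u n, hu n⟩) :=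
      funext fun ω => (Real.exp_log (ω.2.1 _)).symm
    rw [hexp]
    exact Real.measurable_exp.comp ((measurable_pi_apply _).comp (comap_measurable L))
  exact @measurable_of_tendsto_metrizable _ _ (_) _ _ _ _ _ _ heval
    (tendsto_pi_nhds.2 fun ω => (ω.1.continuous.tendsto t).comp hut)

/-- The functions `g` such that the shift by `g` leaves the law `P` quasi-invariant. -/
def quasiInvariantShifts (P : Measure (PosPath 0 T s₀)) : Set (NullStart T) :=
  {g | Measure.QuasiMeasurePreserving (fun ω => ω.shift g) P P}

/-- Every continuous function which vanishes up to the time `b` is a uniform limit of functions of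
the family `𝒢` which vanish up to an earlier time `a`. The two times differ so that the property
passes to a countable subfamily. -/
def IsDenseInFuture (𝒢 : Set (NullStart T)) : Prop :=
  ∀ a b : Set.Icc (0 : ℝ) T, a < b → ∀ f : C(Set.Icc (0 : ℝ) T, ℝ), (∀ t ≤ b, f t = 0) →
    ∀ r > 0, ∃ g ∈ 𝒢, (∀ t ≤ a, g.1 t = 0) ∧ ∀ t, |g.1 t - f t| < r

theorem IsDenseInFuture.exists_countable {𝒢 : Set (NullStart T)} (h𝒢 : IsDenseInFuture 𝒢) :
    ∃ 𝒢' ⊆ 𝒢, 𝒢'.Countable ∧ IsDenseInFuture 𝒢' := by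
  obtain ⟨D, hDc, hDd⟩ := TopologicalSpace.exists_countable_dense (Set.Icc (0 : ℝ) T)
  have hsep (d : Set.Icc (0 : ℝ) T) : ∃ 𝒟 ⊆ {g ∈ 𝒢 | ∀ t ≤ d, g.1 t = 0}, 𝒟.Countable ∧
      {g ∈ 𝒢 | ∀ t ≤ d, g.1 t = 0} ⊆ closure 𝒟 :=
    (TopologicalSpace.IsSeparable.of_separableSpace _).exists_countable_dense_subset
  choose 𝒟 h𝒟 h𝒟c h𝒟d using hsep
  refine ⟨⋃ d ∈ D, 𝒟 d, iUnion₂_subset fun d _ g hg => (h𝒟 d hg).1,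
    hDc.biUnion fun d _ => h𝒟c d, fun a b hab f hf r hr => ?_⟩
  obtain ⟨d, hd, had, hdb⟩ := hDd.exists_between hab
  obtain ⟨h, hh, hh0, hhf⟩ := h𝒢 d b hdb f hf (r / 2) (half_pos hr)
  obtain ⟨g, hg, hgh⟩ := Metric.mem_closure_iff.1 (h𝒟d d ⟨hh, hh0⟩) (r / 2) (half_pos hr)
  refine ⟨g, mem_biUnion hd hg, fun t ht => (h𝒟 d hg).2 t (ht.trans had.le), fun t => ?_⟩
  have hgt : |g.1 t - h.1 t| < r / 2 := by
    rw [abs_sub_comm]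
    exact (ContinuousMap.dist_apply_le_dist t).trans_lt hgh
  calc |g.1 t - f t| ≤ |g.1 t - h.1 t| + |h.1 t - f t| := abs_sub_le _ _ _
    _ < r / 2 + r / 2 := add_lt_add hgt (hhf t)
    _ = r := add_halves r

/-- The restriction to `[0, T]` of a continuous function on the line which vanishes at the
origin. -/
def NullStart.ofReal (h : ℝ → ℝ) (hh : Continuous h) (h0 : h 0 = 0) : NullStart T :=
  ⟨⟨fun t => h t, hh.comp continuous_subtype_val⟩, fun t ht => by simpa [ht] using h0⟩

/- A continuous function on `[0, T]` is extended by a cut-off, then smoothed inside its support. -/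
theorem isDenseInFuture_of_contDiff {𝒢 : Set (NullStart T)}
    (h𝒢 : ∀ (h : ℝ → ℝ) (hh : ContDiff ℝ (⊤ : ℕ∞) h) (h0 : h 0 = 0), HasCompactSupport h →
      NullStart.ofReal h hh.continuous h0 ∈ 𝒢) : IsDenseInFuture 𝒢 := by
  intro a b hab f hf r hr
  have hT : 0 ≤ T := a.2.1.trans a.2.2
  set F : ℝ → ℝ := fun x => Set.IccExtend hT f x * max 0 (min 1 (T + 1 - x))
  have hFc : Continuous F := by
    have : Continuous (Set.IccExtend hT f) := f.continuous.Icc_extend'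
    fun_prop
  have hFb : ∀ x ≤ (b : ℝ), F x = 0 := fun x hx => by
    have hproj : Set.projIcc 0 T hT x ≤ b := by
      simpa only [Set.projIcc_val] using Set.monotone_projIcc hT hx
    simp only [F, Set.IccExtend, Function.comp_apply, hf _ hproj, zero_mul]
  have hFT : ∀ x, T + 1 ≤ x → F x = 0 := fun x hx => by
    have : max 0 (min 1 (T + 1 - x)) = 0 := max_eq_left ((min_le_right _ _).trans (by linarith))
    simp only [F, this, mul_zero]
  have hFf (t : Set.Icc (0 : ℝ) T) : F t = f t := by
    have : max 0 (min 1 (T + 1 - (t : ℝ))) = 1 := by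
      rw [min_eq_left (by linarith [t.2.2]), max_eq_right zero_le_one]
    simp only [F, this, mul_one]
    exact Set.IccExtend_val hT f t
  obtain ⟨h, hh, hhF, hsupp⟩ := hFc.exists_contDiff_approx ⊤ continuous_const fun _ => hr
  have hh0 : ∀ x, F x = 0 → h x = 0 := fun x hx => by
    by_contra hne
    exact hsupp hne hx
  have hcomp : HasCompactSupport h := .intro (isCompact_Icc (a := 0) (b := T + 1)) fun x hx => by
    rcases not_and_or.1 hx with hx | hx
    · exact hh0 x (hFb x ((not_le.1 hx).le.trans b.2.1))
    · exact hh0 x (hFT x (not_le.1 hx).le)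
  refine ⟨_, h𝒢 h hh (hh0 0 (hFb 0 b.2.1)) hcomp, fun t ht => ?_, fun t => ?_⟩
  · exact hh0 t (hFb t (ht.trans hab.le))
  · rw [← hFf t]
    exact hhF t

end Shift

section Law

variable {T s₀ : ℝ} {E : Type*} [MeasurableSpace E] {Q : Measure E}

theorem absolutelyContinuous_of_map {Ω G : Type*} {mΩ : MeasurableSpace Ω} [mG : MeasurableSpace G]
    {P P' : Measure Ω} {L : Ω → G} (hL : Measurable L) (hle : mΩ ≤ mG.comap L)
    (h : P.map L ≪ P'.map L) : P ≪ P' := by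
  refine Measure.AbsolutelyContinuous.mk fun s hs hs0 => ?_
  obtain ⟨M, hM, rfl⟩ := hle s hs
  rw [← Measure.map_apply hL hM] at hs0 ⊢
  exact h hs0

theorem IsPathLaw.mem_quasiInvariantShifts {P : Measure (PosPath 0 T s₀)}
    {Z : Set.Icc (0 : ℝ) T → E → ℝ} (hP : IsPathLaw (fun t e => Real.exp (Z t e)) Q P)
    {D : Set (Set.Icc (0 : ℝ) T)} (hDc : D.Countable) (hD : Dense D) {g : NullStart T}
    (hg : Q.map (fun e (t : D) => Z t e + g.1 t) ≪ Q.map fun e (t : D) => Z t e) :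
    g ∈ quasiInvariantShifts P := by
  obtain ⟨X, hX, hXZ⟩ := hP
  have := hDc.to_subtype
  set L : PosPath 0 T s₀ → D → ℝ := fun ω t => Real.log (ω t)
  have hL : Measurable L := measurable_pi_lambda _ fun t =>
    Real.measurable_log.comp (PosPath.measurable_eval _)
  have hLX : ∀ᵐ e ∂Q, L (X e) = fun t : D => Z t e := by
    filter_upwards [ae_all_iff.2 fun t : D => hXZ t] with e he
    ext t
    simp only [L, he, Real.log_exp]
  have hLshift (ω : PosPath 0 T s₀) : L (ω.shift g) = fun t => L ω t + g.1 t :=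
    funext fun t => PosPath.log_shift ω g t
  have hshift := PosPath.measurable_shift (s₀ := s₀) g
  refine ⟨hshift, absolutelyContinuous_of_map hL (PosPath.cylinderSigma_le_comap_log hD) ?_⟩
  rw [Measure.map_map hL hshift, ← hX.map_eq,
    AEMeasurable.map_map_of_aemeasurable (hL.comp hshift).aemeasurable hX.aemeasurable,
    AEMeasurable.map_map_of_aemeasurable hL.aemeasurable hX.aemeasurable]
  convert hg using 1
  · refine Measure.map_congr ?_
    filter_upwards [hLX] with e he
    simp only [Function.comp_apply, hLshift, he]
  · exact Measure.map_congr hLX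

theorem IsFBm.integral_sq_sum {H : ℝ} {B : Set.Icc (0 : ℝ) T → E → ℝ} (hB : IsFBm H B Q)
    {ι : Type*} (F : Finset ι) (c : ι → ℝ) (t : ι → Set.Icc (0 : ℝ) T) :
    ∫ e, (∑ i ∈ F, c i * B (t i) e) ^ 2 ∂Q =
      ∑ i ∈ F, ∑ j ∈ F, c i * c j * fBmKernel H (t i) (t j) := by
  have := hB.gaussian.isProbabilityMeasure
  have hB2 (t : Set.Icc (0 : ℝ) T) : MemLp (B t) 2 Q :=
    (hB.gaussian.hasGaussianLaw_eval t).memLp_two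
  have hint (i j : ι) : Integrable (fun e => c i * c j * (B (t i) e * B (t j) e)) Q :=
    ((hB2 _).integrable_mul (hB2 _)).const_mul _
  have hcov (i j : ι) : ∫ e, B (t i) e * B (t j) e ∂Q = fBmKernel H (t i) (t j) := by
    have h := hB.covariance (t i) (t j)
    rw [covariance_eq_sub (hB2 _) (hB2 _), hB.centered, zero_mul, sub_zero] at h
    rw [fBmKernel, abs_of_nonneg (t i).2.1, abs_of_nonneg (t j).2.1, ← h]
    rfl
  have hexpand (e : E) : (∑ i ∈ F, c i * B (t i) e) ^ 2 =
      ∑ i ∈ F, ∑ j ∈ F, c i * c j * (B (t i) e * B (t j) e) := by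
    rw [sq, Finset.sum_mul_sum]
    exact Finset.sum_congr rfl fun i _ => Finset.sum_congr rfl fun j _ => by ring
  simp only [hexpand]
  rw [integral_finsetSum _ fun i _ => integrable_finsetSum _ fun j _ => hint i j]
  refine Finset.sum_congr rfl fun i _ => ?_
  rw [integral_finsetSum _ fun j _ => hint i j]
  exact Finset.sum_congr rfl fun j _ => by rw [integral_const_mul, hcov]

theorem IsFBm.map_add_absolutelyContinuous {H : ℝ} (hH : 0 < H) (hH1 : H < 1)
    {B : Set.Icc (0 : ℝ) T → E → ℝ} (hB : IsFBm H B Q) {D : Set (Set.Icc (0 : ℝ) T)}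
    (hD : D.Countable) {h : ℝ → ℝ} (hh : ContDiff ℝ (⊤ : ℕ∞) h) (h0 : h 0 = 0)
    (hcomp : HasCompactSupport h) :
    Q.map (fun e (t : D) => B t e + h t) ≪ Q.map fun e (t : D) => B t e := by
  have := hD.to_subtype
  have hcomp' : HasCompactSupport fun x => (h x : ℂ) := hcomp.comp_left Complex.ofReal_zero
  set f := hcomp'.toSchwartzMap (Complex.ofRealCLM.contDiff.comp hh)
  have hf (x : ℝ) : f x = h x := rfl
  obtain ⟨C, hC⟩ := exists_norm_sq_sum_le_fBmKernel hH hH1 f (by simp [hf, h0])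
  refine map_add_absolutelyContinuous_of_sq_le (hB.gaussian.comp_right fun t : D => (t : Icc 0 T))
    (fun t => hB.centered t) (fun t => h t) (C := C) fun c => ?_
  have hsum : ∑ t ∈ c.support, (c t : ℂ) * f (t : Icc 0 T) =
      ((c.sum fun t a => a * h t : ℝ) : ℂ) := by
    simp only [hf, Finsupp.sum, Complex.ofReal_sum, Complex.ofReal_mul]
  have hle := hC c.support c fun t : D => (t : Icc 0 T)
  rwa [hsum, Complex.norm_real, Real.norm_eq_abs, sq_abs, ← hB.integral_sq_sum] at hle

theorem IsPathLaw.isDenseInFuture_quasiInvariantShifts {H σ : ℝ} (hH : 0 < H) (hH1 : H < 1)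
    (hσ : σ ≠ 0) {B Y : Set.Icc (0 : ℝ) T → E → ℝ} (hB : IsFBm H B Q)
    (hY : ∀ t, AEMeasurable (Y t) Q)
    (hBY : IndepFun (fun e t => B t e) (fun e t => Y t e) Q) {P : Measure (PosPath 0 T s₀)}
    (hP : IsPathLaw (fun t e => Real.exp (σ * B t e + Y t e)) Q P) :
    IsDenseInFuture (quasiInvariantShifts P) := by
  refine isDenseInFuture_of_contDiff fun h hh h0 hcomp => ?_
  obtain ⟨D, hDc, hD⟩ := TopologicalSpace.exists_countable_dense (Set.Icc (0 : ℝ) T)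
  refine hP.mem_quasiInvariantShifts hDc hD ?_
  have := hDc.to_subtype
  have := hB.gaussian.isProbabilityMeasure
  set scale : (D → ℝ) → D → ℝ := fun u t => σ * u t
  have hscale : Measurable scale := by fun_prop
  set h' : ℝ → ℝ := fun x => σ⁻¹ * h x
  have hBm : AEMeasurable (fun e (t : D) => B t e) Q :=
    aemeasurable_pi_lambda _ fun t => hB.gaussian.aemeasurable t
  have hBm' : AEMeasurable (fun e (t : D) => B t e + h' t) Q :=
    aemeasurable_pi_lambda _ fun t => (hB.gaussian.aemeasurable t).add_const _
  have hB' : Q.map (fun e (t : D) => B t e + h' t) ≪ Q.map fun e (t : D) => B t e :=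
    hB.map_add_absolutelyContinuous hH hH1 hDc (contDiff_const.mul hh) (by simp [h', h0])
      hcomp.mul_left
  have hYD : AEMeasurable (fun e (t : D) => Y t e) Q := aemeasurable_pi_lambda _ fun t => hY t
  have hrestrict : Measurable fun (u : Icc (0 : ℝ) T → ℝ) (t : D) => u t := by fun_prop
  have hind : IndepFun (fun e (t : D) => Y t e) (fun e (t : D) => B t e) Q :=
    (hBY.comp hrestrict hrestrict).symm
  have hadd : Measurable fun (u : D → ℝ) (t : D) => u t + h' t := by fun_prop
  have hsum := map_add_absolutelyContinuous_of_indepFun hYD (hscale.comp_aemeasurable hBm)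
    (hscale.comp_aemeasurable hBm') (hind.comp measurable_id hscale)
    (hind.comp measurable_id (hscale.comp hadd)) (by
      rw [← AEMeasurable.map_map_of_aemeasurable hscale.aemeasurable hBm,
        ← AEMeasurable.map_map_of_aemeasurable hscale.aemeasurable hBm']
      exact hB'.map hscale)
  convert hsum using 2 <;>
  · ext e t
    simp only [Pi.add_apply, Function.comp_apply, scale, h', NullStart.ofReal,
      ContinuousMap.coe_mk]
    field_simp
    ring

end Law

section Invariance

variable {Ω β γ : Type*} [MeasurableSpace Ω] {P : Measure Ω} {R R' : Ω → Ω → Prop}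

/-- The function `f` takes the same value at any two points which are related by `R` and lie
outside a suitable null set. -/
def IsAEInvariant (P : Measure Ω) (R : Ω → Ω → Prop) (f : Ω → β) : Prop :=
  ∃ A ∈ ae P, ∀ ω ∈ A, ∀ ω' ∈ A, R ω ω' → f ω = f ω'

theorem IsAEInvariant.of_ae_eq_const {f : Ω → β} {c : β} (hf : ∀ᵐ ω ∂P, f ω = c) :
    IsAEInvariant P R f :=
  ⟨_, hf, fun _ hω _ hω' _ => Eq.trans hω (Eq.symm hω')⟩

theorem IsAEInvariant.mono {f : Ω → β} (hf : IsAEInvariant P R' f)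
    (hR : ∀ ω ω', R ω ω' → R' ω ω') : IsAEInvariant P R f :=
  let ⟨A, hA, h⟩ := hf
  ⟨A, hA, fun ω hω ω' hω' hωω' => h ω hω ω' hω' (hR ω ω' hωω')⟩

theorem IsAEInvariant.comp {f : Ω → β} (hf : IsAEInvariant P R f) (g : β → γ) :
    IsAEInvariant P R fun ω => g (f ω) :=
  let ⟨A, hA, h⟩ := hf
  ⟨A, hA, fun ω hω ω' hω' hR => congrArg g (h ω hω ω' hω' hR)⟩

theorem IsAEInvariant.of_comp_injective {f : Ω → β} {g : β → γ} (hg : Function.Injective g)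
    (hf : IsAEInvariant P R fun ω => g (f ω)) : IsAEInvariant P R f :=
  let ⟨A, hA, h⟩ := hf
  ⟨A, hA, fun ω hω ω' hω' hR => hg (h ω hω ω' hω' hR)⟩

theorem IsAEInvariant.pi {ι : Type*} [Countable ι] {f : ι → Ω → β}
    (hf : ∀ i, IsAEInvariant P R (f i)) : IsAEInvariant P R fun ω i => f i ω := by
  choose A hA h using hf
  exact ⟨⋂ i, A i, countable_iInter_mem.2 hA, fun ω hω ω' hω' hR => funext fun i =>
    h i ω (mem_iInter.1 hω i) ω' (mem_iInter.1 hω' i) hR⟩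

/-- The σ-algebra of the sets which are almost everywhere invariant under `R`. -/
@[reducible] def determinedSigma (P : Measure Ω) (R : Ω → Ω → Prop) : MeasurableSpace Ω where
  MeasurableSet' s := IsAEInvariant P R (· ∈ s)
  measurableSet_empty := .of_ae_eq_const (.of_forall fun _ => rfl)
  measurableSet_compl _ hs := hs.comp Not
  measurableSet_iUnion s hs := by
    simpa only [mem_iUnion] using (IsAEInvariant.pi hs).comp fun p : ℕ → Prop => ∃ i, p i

theorem isAEInvariant_of_measurable [MeasurableSpace β]
    [MeasurableSpace.CountablySeparated β] {f : Ω → β}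
    (hf : Measurable[determinedSigma P R] f) : IsAEInvariant P R f := by
  obtain ⟨S, hS, hsep⟩ := exists_seq_separating β MeasurableSet.empty univ
  exact .of_comp_injective (g := fun x n => x ∈ S n)
    (fun x y hxy => hsep x trivial y trivial fun n => (congrFun hxy n).to_iff)
    (.pi fun n => hf (hS n))

theorem isAEInvariant_section [mβ : MeasurableSpace β] {Γ : Set (Ω × β)}
    (hΓ : MeasurableSet[(determinedSigma P R).prod mβ] Γ) :
    IsAEInvariant P R fun ω => Prod.mk ω ⁻¹' Γ := by
  rw [show (determinedSigma P R).prod mβ = _ from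
    (@generateFrom_prod _ _ (determinedSigma P R) mβ).symm] at hΓ
  induction Γ, hΓ using MeasurableSpace.generateFrom_induction with
  | hC Γ hΓ =>
    obtain ⟨s, hs, t, -, rfl⟩ := hΓ
    exact IsAEInvariant.comp hs fun p : Prop => {y | p ∧ y ∈ t}
  | empty => exact .of_ae_eq_const (c := ∅) (.of_forall fun _ => rfl)
  | compl Γ _ ih => exact ih.comp compl
  | iUnion Γ _ ih => simpa only [preimage_iUnion] using (IsAEInvariant.pi ih).comp (⋃ n, · n)

end Invariance

section Stopping

variable {T s₀ : ℝ} {P : Measure (PosPath 0 T s₀)}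

/-- The paths `ω` and `ω'` coincide up to some time strictly later than `r`. -/
def PosPath.AgreePast (r : Set.Icc (0 : ℝ) T) (ω ω' : PosPath 0 T s₀) : Prop :=
  ∃ q > r, ∀ t ≤ q, ω t = ω' t

theorem completedFiltration_le_determinedSigma (q : Set.Icc (0 : ℝ) T) :
    completedFiltration P q ≤ determinedSigma P fun ω ω' => ∀ t ≤ q, ω t = ω' t := by
  refine sup_le (iSup₂_le fun s hs => ?_) (MeasurableSpace.generateFrom_le fun N hN => ?_)
  · rintro _ ⟨A, -, rfl⟩
    exact ⟨univ, univ_mem, fun ω _ ω' _ h => congrArg (· ∈ A) (h s hs)⟩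
  · exact .of_ae_eq_const (c := False) ((measure_eq_zero_iff_ae_notMem.1 hN).mono
      fun ω hω => eq_false hω)

theorem usualFiltration_le_completedFiltration {r q : Set.Icc (0 : ℝ) T} (hrq : r < q) :
    usualFiltration P r ≤ completedFiltration P q := by
  rw [usualFiltration, Filtration.rightCont_eq_of_not_isMax _ (not_isMax_iff.2 ⟨q, hrq⟩)]
  exact iInf₂_le q hrq

theorem usualFiltration_le_determinedSigma (r : Set.Icc (0 : ℝ) T) :
    usualFiltration P r ≤ determinedSigma P (PosPath.AgreePast r) := by
  intro s hs
  obtain ⟨D, hDc, hD⟩ := TopologicalSpace.exists_countable_dense (Set.Icc (0 : ℝ) T)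
  have hlater : ∀ d > r, IsAEInvariant P (fun ω ω' => ∀ t ≤ d, ω t = ω' t) (· ∈ s) :=
    fun d hd => completedFiltration_le_determinedSigma d s
      (usualFiltration_le_completedFiltration hd s hs)
  choose! A hA h using hlater
  refine ⟨⋂ d ∈ {d ∈ D | r < d}, A d, (countable_bInter_mem (hDc.mono (sep_subset _ _))).2
    fun d hd => hA d hd.2, fun ω hω ω' hω' ⟨q, hrq, hq⟩ => ?_⟩
  obtain ⟨d, hd, hrd, hdq⟩ := hD.exists_between hrq
  exact h d hrd ω (mem_iInter₂.1 hω d ⟨hd, hrd⟩) ω' (mem_iInter₂.1 hω' d ⟨hd, hrd⟩)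
    fun t ht => hq t (ht.trans hdq.le)

variable {n : ℕ} (τ : StoppingSeq P n)

/-- The paths `ω` and `ω'` coincide up to some time strictly later than `τₖ(ω)`. -/
def StoppingSeq.Agree (k : Fin (n + 1)) (ω ω' : PosPath 0 T s₀) : Prop :=
  PosPath.AgreePast (τ.time k ω) ω ω'

variable {τ} in
theorem StoppingSeq.Agree.mono {j k : Fin (n + 1)} (hjk : j ≤ k) {ω ω' : PosPath 0 T s₀}
    (h : τ.Agree k ω ω') : τ.Agree j ω ω' :=
  let ⟨q, hq, hωω'⟩ := h
  ⟨q, (τ.monotone ω hjk).trans_lt hq, hωω'⟩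

theorem StoppingSeq.sigma_le_determinedSigma (k : Fin (n + 1)) :
    τ.sigma k ≤ determinedSigma P (τ.Agree k) := by
  intro s hs
  obtain ⟨D, hDc, hD⟩ := TopologicalSpace.exists_countable_dense (Set.Icc (0 : ℝ) T)
  have htime (d : Set.Icc (0 : ℝ) T) :
      IsAEInvariant P (PosPath.AgreePast d) fun ω => τ.time k ω ≤ d := by
    have h := usualFiltration_le_determinedSigma d _ (τ.isStoppingTime k d)
    simp only [WithTop.coe_le_coe] at h
    exact h
  have hprior (d : Set.Icc (0 : ℝ) T) :
      IsAEInvariant P (PosPath.AgreePast d) fun ω => ω ∈ s ∧ τ.time k ω ≤ d := by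
    have h := usualFiltration_le_determinedSigma d _ (hs.2 d)
    simp only [WithTop.coe_le_coe] at h
    exact h
  choose A hA hτA using htime
  choose A' hA' hsA' using hprior
  refine ⟨⋂ d ∈ D, A d ∩ A' d, (countable_bInter_mem hDc).2 fun d _ => inter_mem (hA d) (hA' d),
    fun ω hω ω' hω' ⟨q, hq, hωω'⟩ => ?_⟩
  obtain ⟨d, hd, hτd, hdq⟩ := hD.exists_between hq
  obtain ⟨hωA, hωA'⟩ := mem_iInter₂.1 hω d hd
  obtain ⟨hω'A, hω'A'⟩ := mem_iInter₂.1 hω' d hd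
  have hd' : τ.time k ω' ≤ d := (hτA d ω hωA ω' hω'A ⟨q, hdq, hωω'⟩).mp hτd.le
  simpa only [hτd.le, hd', and_true] using hsA' d ω hωA' ω' hω'A' ⟨q, hdq, hωω'⟩

theorem StoppingSeq.isAEInvariant {β : Type*} [MeasurableSpace β]
    [MeasurableSpace.CountablySeparated β] {k : Fin (n + 1)} {f : PosPath 0 T s₀ → β}
    (hf : Measurable[τ.sigma k] f) :
    IsAEInvariant P (τ.Agree k) f :=
  isAEInvariant_of_measurable (hf.mono (τ.sigma_le_determinedSigma k) le_rfl)

theorem StoppingSeq.isAEInvariant_time (k : Fin (n + 1)) :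
    IsAEInvariant P (τ.Agree k) (τ.time k) :=
  .of_comp_injective WithTop.coe_injective (τ.isAEInvariant (τ.isStoppingTime k).measurable)

end Stopping

section Steering

variable {T s₀ : ℝ} {P : Measure (PosPath 0 T s₀)}

theorem ae_forall_shift {𝒢 : Set (NullStart T)} (hc : 𝒢.Countable)
    (h𝒢 : 𝒢 ⊆ quasiInvariantShifts P) {A : Set (PosPath 0 T s₀)} (hA : A ∈ ae P) :
    ∀ᵐ ω ∂P, ∀ g ∈ 𝒢, ω.shift g ∈ A :=
  (ae_ball_iff hc).2 fun _ hg => (h𝒢 hg).ae hA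

theorem PosPath.continuous_log (ω : PosPath 0 T s₀) : Continuous fun t => Real.log (ω t) :=
  ω.1.continuous.log fun t => (ω.2.1 t).ne'

/-- In the logarithmic scale the path `ω` can be continued, after any time `a` and within the set
`A`, towards any target `m`. The target is almost reached at the time `b`; in the meantime the new
path is almost a convex combination of `ω` and `m`, hence stays in the intervals which contain
both. -/
def PosPath.IsSteerable (A : Set (PosPath 0 T s₀)) (ω : PosPath 0 T s₀) : Prop :=
  ∀ a b : Set.Icc (0 : ℝ) T, a < b → ∀ m : C(Set.Icc (0 : ℝ) T, ℝ), ∀ δ > 0,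
    ∃ ω' ∈ A, (∀ t ≤ a, ω' t = ω t) ∧ (∀ t ≥ b, |Real.log (ω' t) - m t| < δ) ∧
      ∀ t x r, |Real.log (ω t) - x| ≤ r → |m t - x| ≤ r → |Real.log (ω' t) - x| < r + δ

theorem IsDenseInFuture.ae_isSteerable (hP : IsDenseInFuture (quasiInvariantShifts P))
    {A : Set (PosPath 0 T s₀)} (hA : A ∈ ae P) : ∀ᵐ ω ∂P, ω.IsSteerable A := by
  obtain ⟨𝒢, h𝒢, h𝒢c, h𝒢d⟩ := hP.exists_countable
  filter_upwards [ae_forall_shift h𝒢c h𝒢 hA] with ω hω a b hab m δ hδ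
  obtain ⟨a', haa', ha'b⟩ := exists_between hab
  have hpos : (0 : ℝ) < b - a' := sub_pos.2 ha'b
  let l : Set.Icc (0 : ℝ) T → ℝ := fun t => max 0 (min 1 (((t : ℝ) - a') / (b - a')))
  have hl : Continuous l := by fun_prop
  have hl0 (t) : 0 ≤ l t := le_max_left _ _
  have hl1 (t) : 0 ≤ 1 - l t := sub_nonneg.2 (max_le zero_le_one (min_le_left _ _))
  let f : C(Set.Icc (0 : ℝ) T, ℝ) :=
    ⟨fun t => l t * (m t - Real.log (ω t)), hl.mul (m.continuous.sub ω.continuous_log)⟩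
  have hf (t : Set.Icc (0 : ℝ) T) (ht : t ≤ a') : f t = 0 := by
    have : l t = 0 := max_eq_left ((min_le_right _ _).trans
      (div_nonpos_of_nonpos_of_nonneg (sub_nonpos.2 ht) hpos.le))
    simp only [f, ContinuousMap.coe_mk, this, zero_mul]
  obtain ⟨g, hg, hga, hgf⟩ := h𝒢d a a' haa' f hf δ hδ
  have hlog (t) : |Real.log (ω.shift g t) - ((1 - l t) * Real.log (ω t) + l t * m t)| < δ := by
    convert hgf t using 2
    rw [PosPath.log_shift]
    simp only [f, ContinuousMap.coe_mk]
    ring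
  refine ⟨ω.shift g, hω g hg, fun t ht => ?_, fun t ht => ?_, fun t x r hωx hmx => ?_⟩
  · rw [PosPath.shift_apply, hga t ht, Real.exp_zero, mul_one]
  · have h1 : 1 ≤ ((t : ℝ) - a') / (b - a') :=
      (one_le_div₀ hpos).2 (sub_le_sub_right (Subtype.coe_le_coe.2 ht) _)
    have : l t = 1 := by simp only [l, min_eq_left h1, max_eq_right zero_le_one]
    simpa only [this, sub_self, zero_mul, zero_add, one_mul] using hlog t
  · have hconvex : |(1 - l t) * Real.log (ω t) + l t * m t - x| ≤ r := by
      have := convex_closedBall x r hωx hmx (hl1 t) (hl0 t) (sub_add_cancel _ _)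
      simpa only [smul_eq_mul, mem_closedBall_iff_norm, Real.norm_eq_abs] using this
    calc _ ≤ _ := abs_sub_le _ ((1 - l t) * Real.log (ω t) + l t * m t) _
      _ < δ + r := add_lt_add_of_lt_of_le (hlog t) hconvex
      _ = r + δ := add_comm _ _

theorem PosPath.exists_log_ball_subset {a b x : ℝ} {U : Set (PosPath a b x)} (hU : IsOpen U)
    {u : PosPath a b x} (hu : u ∈ U) :
    ∃ ρ > 0, ∀ v : PosPath a b x, (∀ t, |Real.log (v t) - Real.log (u t)| < ρ) → v ∈ U := by
  obtain ⟨r, hr, hball⟩ := Metric.isOpen_iff.1 hU u hu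
  set M := ‖u.1‖ + 1
  have hM : 0 < M := by positivity
  have hexp : Tendsto Real.exp (𝓝 0) (𝓝 1) := Real.exp_zero ▸ Real.continuous_exp.tendsto 0
  obtain ⟨ρ, hρ, hρr⟩ := Metric.tendsto_nhds_nhds.1 hexp (r / 2 / M) (by positivity)
  refine ⟨ρ, hρ, fun v hv => hball ?_⟩
  change dist v.1 u.1 < r
  refine ((ContinuousMap.dist_le (half_pos hr).le).2 fun t => ?_).trans_lt (half_lt_self hr)
  set d := Real.log (v t) - Real.log (u t)
  have hd : |Real.exp d - 1| < r / 2 / M := by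
    simpa only [Real.dist_eq, sub_zero] using hρr (x := d) (by simpa using hv t)
  have hvu : v t - u t = u t * (Real.exp d - 1) := by
    rw [Real.exp_sub, Real.exp_log (v.2.1 t), Real.exp_log (u.2.1 t), mul_sub, mul_one,
      mul_div_cancel₀ _ (u.2.1 t).ne']
  have huM : |u t| ≤ M := (u.1.norm_coe_le_norm t).trans (le_add_of_nonneg_right zero_le_one)
  calc |v t - u t| = |u t| * |Real.exp d - 1| := by rw [hvu, abs_mul]
    _ ≤ M * (r / 2 / M) := by gcongr
    _ = r / 2 := mul_div_cancel₀ _ hM.ne'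

theorem PosPath.exists_log_extension (a : Set.Icc (0 : ℝ) T) {x : ℝ} (u : PosPath a T x) :
    ∃ m : C(Set.Icc (0 : ℝ) T, ℝ),
      ∀ t : Set.Icc (a : ℝ) T, m ⟨t, a.2.1.trans t.2.1, t.2.2⟩ = Real.log (u t) := by
  let e : Set.Icc (0 : ℝ) T → Set.Icc (a : ℝ) T := fun t =>
    ⟨max t a, le_max_right _ _, max_le t.2.2 a.2.2⟩
  have he : Continuous e := by fun_prop
  refine ⟨⟨fun t => Real.log (u (e t)),
    (u.1.continuous.comp he).log fun t => (u.2.1 (e t)).ne'⟩, fun t => ?_⟩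
  exact congrArg (fun t => Real.log (u t)) (Subtype.ext (max_eq_left t.2.1))

/- The target is the logarithm of a path in `U`, displaced by `2 r s`. For small `r` the
displacement does not leave `U`. -/
theorem PosPath.IsSteerable.exists_tail_mem_of_isOpen {A : Set (PosPath 0 T s₀)}
    {ω : PosPath 0 T s₀} (hω : ω.IsSteerable A) {t₀ b' : Set.Icc (0 : ℝ) T} (hb' : t₀ < b')
    {U : Set (PosPath t₀ T (ω t₀))} (hU : IsOpen U) (hne : U.Nonempty) {s : ℝ} (hs : |s| ≤ 1) :
    ∃ r > 0, ∃ ω₁ ∈ A, AgreePast t₀ ω ω₁ ∧ (∃ h, ω₁.tail t₀ _ h ∈ U) ∧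
      ∃ b₁ b₂, t₀ < b₁ ∧ b₁ < b₂ ∧ b₂ < b' ∧
        ∀ t ∈ Set.Icc b₁ b₂, |Real.log (ω₁ t) - (Real.log (ω t₀) + 2 * r * s)| ≤ r := by
  obtain ⟨u, hu⟩ := hne
  obtain ⟨ρ, hρ, hρU⟩ := PosPath.exists_log_ball_subset hU hu
  obtain ⟨m, hm⟩ := PosPath.exists_log_extension t₀ u
  set ℓ := Real.log (ω t₀)
  have hmℓ : m t₀ = ℓ := (hm ⟨t₀, le_rfl, t₀.2.2⟩).trans (congrArg Real.log (u.2.2 _ rfl))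
  obtain ⟨δ, hδ, rfl⟩ : ∃ δ > 0, ρ = 8 * δ := ⟨ρ / 8, by positivity, by ring⟩
  have hnear : ∀ᶠ t in 𝓝[≥] t₀, |Real.log (ω t) - ℓ| < δ ∧ |m t - ℓ| < δ :=
    nhdsWithin_le_nhds ((Metric.tendsto_nhds.1 (ω.continuous_log.tendsto t₀) δ hδ).and
      (hmℓ ▸ Metric.tendsto_nhds.1 (m.continuous.tendsto t₀) δ hδ))
  obtain ⟨b₃, ⟨hb₃, hb₃'⟩, hnear⟩ := (mem_nhdsGE_iff_exists_mem_Ioc_Ico_subset hb').1 hnear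
  obtain ⟨b₂, hb₂, hb₂₃⟩ := exists_between hb₃
  obtain ⟨b₁, hb₁, hb₁₂⟩ := exists_between hb₂
  obtain ⟨a, ha, hab₁⟩ := exists_between hb₁
  obtain ⟨w, hw⟩ : ∃ w, w = 2 * (2 * δ) * s := ⟨_, rfl⟩
  have hwδ := abs_le.1 (show |w| ≤ 4 * δ by
    rw [hw, abs_mul, abs_of_pos (by positivity)]
    linarith [mul_le_of_le_one_right hδ.le hs])
  obtain ⟨ω₁, hω₁, hagree, htarget, hhull⟩ :=
    hω a b₁ hab₁ (m + ContinuousMap.const _ w) δ hδ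
  simp only [ContinuousMap.add_apply, ContinuousMap.const_apply] at htarget hhull
  refine ⟨2 * δ, by positivity, ω₁, hω₁, ⟨a, ha, fun t ht => (hagree t ht).symm⟩,
    ⟨hagree t₀ ha.le, hρU _ fun t => ?_⟩, b₁, b₂, hb₁, hb₁₂, hb₂₃.trans_le hb₃', fun t ht => ?_⟩
  · set t' : Set.Icc (0 : ℝ) T := ⟨t, t₀.2.1.trans t.2.1, t.2.2⟩
    change |Real.log (ω₁ t') - Real.log (u t)| < 8 * δ
    rw [← hm t]
    rcases le_total b₁ t' with hbt | htb
    · have hω₁t := abs_lt.1 (htarget t' hbt)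
      exact abs_lt.2 ⟨by linarith, by linarith⟩
    · obtain ⟨hωt, hmt⟩ := hnear ⟨t.2.1, htb.trans_lt (hb₁₂.trans hb₂₃)⟩
      have hmt := abs_lt.1 hmt
      have hω₁t := abs_lt.1 (hhull t' ℓ (5 * δ) (by linarith)
        (abs_le.2 ⟨by linarith, by linarith⟩))
      exact abs_lt.2 ⟨by linarith, by linarith⟩
  · have hmt := abs_lt.1 (hnear ⟨hb₁.le.trans ht.1, ht.2.trans_lt hb₂₃⟩).2
    have hω₁t := abs_lt.1 (htarget t ht.1)
    rw [← hw]
    exact abs_le.2 ⟨by linarith, by linarith⟩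

theorem PosPath.IsSteerable.exists_tail_mem_and_adverse {A : Set (PosPath 0 T s₀)}
    {ω : PosPath 0 T s₀} (hω : ω.IsSteerable {ω₁ ∈ A | ω₁.IsSteerable A})
    {t₀ b' : Set.Icc (0 : ℝ) T} (hb' : t₀ < b') {U : Set (PosPath t₀ T (ω t₀))} (hU : IsOpen U)
    (hne : U.Nonempty) {c : ℝ} (hc : c ≠ 0) :
    ∃ ω₁ ∈ A, AgreePast t₀ ω ω₁ ∧ (∃ h, ω₁.tail t₀ _ h ∈ U) ∧ ∃ ω₂ ∈ A, ∃ b ∈ Set.Ioo t₀ b',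
      (∀ t ≤ b, ω₂ t = ω₁ t) ∧ ∀ t ≥ b, 0 < c * (Real.log (ω₂ t) - Real.log (ω t₀)) := by
  have hs : |(c / |c|)| = 1 := by rw [abs_div, abs_abs, div_self (abs_ne_zero.2 hc)]
  obtain ⟨r, hr, ω₁, ⟨hω₁A, hω₁⟩, hagree, hmem, b, b₂, hb, hbb₂, hb₂, hnear⟩ :=
    hω.exists_tail_mem_of_isOpen hb' hU hne hs.le
  set x := Real.log (ω t₀) + 2 * r * (c / |c|)
  obtain ⟨ω₂, hω₂, hω₂₁, htarget, hhull⟩ := hω₁ b b₂ hbb₂ (.const _ x) r hr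
  simp only [ContinuousMap.const_apply] at htarget hhull
  refine ⟨ω₁, hω₁A, hagree, hmem, ω₂, hω₂, b, ⟨hb, hbb₂.trans hb₂⟩, hω₂₁, fun t ht => ?_⟩
  have hx : |Real.log (ω₂ t) - x| < 2 * r := by
    rcases le_total b₂ t with hbt | htb
    · linarith [htarget t hbt]
    · linarith [hhull t x r (hnear t ⟨ht, htb⟩) (by simpa using hr.le)]
  have hcc : c * (c / |c|) = |c| := by
    rw [← mul_div_assoc, ← abs_mul_abs_self c, mul_div_cancel_right₀ _ (abs_ne_zero.2 hc)]
  have hbound : |c * (Real.log (ω₂ t) - x)| < |c| * (2 * r) := by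
    rw [abs_mul]
    exact mul_lt_mul_of_pos_left hx (abs_pos.2 hc)
  calc 0 < c * (Real.log (ω₂ t) - x) + |c| * (2 * r) := by linarith [(abs_lt.1 hbound).1]
    _ = c * (Real.log (ω₂ t) - Real.log (ω t₀)) := by rw [← hcc]; ring

theorem PosPath.AgreePast.symm {r : Set.Icc (0 : ℝ) T} {ω ω' : PosPath 0 T s₀}
    (h : AgreePast r ω ω') : AgreePast r ω' ω :=
  let ⟨q, hq, hωω'⟩ := h
  ⟨q, hq, fun t ht => (hωω' t ht).symm⟩

theorem mul_sub_pos_of_mul_log_sub_log_pos {x y c : ℝ} (hx : 0 < x) (hy : 0 < y)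
    (h : 0 < c * (Real.log x - Real.log y)) : 0 < c * (x - y) := by
  rcases mul_pos_iff.1 h with ⟨hc, hxy⟩ | ⟨hc, hxy⟩
  · exact mul_pos hc (sub_pos.2 ((Real.log_lt_log_iff hy hx).1 (sub_pos.1 hxy)))
  · exact mul_pos_of_neg_of_neg hc (sub_neg.2 ((Real.log_lt_log_iff hx hy).1 (sub_neg.1 hxy)))

variable {n : ℕ} {τ : StoppingSeq P n}

/- The random set and the random delay are determined by the path up to `τₖ`, hence can be frozen
at their values on one path. -/
theorem StoppingSeq.HasDelay.exists_delay_of_agree (hτ : τ.HasDelay) (k : Fin n) :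
    ∃ A ∈ ae P, ∀ ω ∈ A, ∃ V : Set (PosPath (τ.time k.castSucc ω) T (ω (τ.time k.castSucc ω))),
      IsOpen V ∧ V.Nonempty ∧ ∃ ε > 0, ∀ ω₁ ∈ A, τ.Agree k.castSucc ω ω₁ →
        (∃ h, ω₁.tail (τ.time k.castSucc ω) _ h ∈ V) → τ.time k.castSucc ω < τ.time k.succ ω₁ →
        ε ≤ (τ.time k.succ ω₁ : ℝ) - τ.time k.castSucc ω := by
  obtain ⟨U, ε, hU, hUne, hUm, hεm, hε, hdelay⟩ := hτ k
  obtain ⟨A₁, hA₁, htime⟩ := τ.isAEInvariant_time k.castSucc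
  obtain ⟨A₂, hA₂, hεinv⟩ := τ.isAEInvariant hεm
  obtain ⟨A₃, hA₃, hUinv⟩ := isAEInvariant_section (sup_le_sup_right
    (MeasurableSpace.comap_mono (τ.sigma_le_determinedSigma k.castSucc)) _ _ hUm)
  refine ⟨A₁ ∩ A₂ ∩ A₃ ∩ {ω | (U ω).Nonempty ∧ 0 < ε ω ∧ (ω.tail (τ.time k.castSucc ω) _ rfl ∈ U ω →
      τ.time k.castSucc ω < τ.time k.succ ω →
      ε ω ≤ (τ.time k.succ ω : ℝ) - (τ.time k.castSucc ω : ℝ))},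
    inter_mem (inter_mem (inter_mem hA₁ hA₂) hA₃) (hUne.and (hε.and hdelay)), ?_⟩
  rintro ω ⟨⟨⟨hω₁, hω₂⟩, hω₃⟩, hne, hεω, -⟩
  refine ⟨U ω, hU ω, hne, ε ω, hεω, ?_⟩
  rintro ω' ⟨⟨⟨hω'₁, hω'₂⟩, hω'₃⟩, -, -, hdelay'⟩ hagree htail hlt
  have hmem := Set.ext_iff.1 (hUinv ω hω₃ ω' hω'₃ hagree) ω'
  obtain ⟨_, htail'⟩ := hmem.1 htail
  rw [htime ω hω₁ ω' hω'₁ hagree] at hlt ⊢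
  exact (hεinv ω hω₂ ω' hω'₂ hagree).trans_le (hdelay' htail' hlt)

theorem StoppingSeq.HasDelay.ae_exists_adverse_path (hτ : τ.HasDelay)
    (hP : IsDenseInFuture (quasiInvariantShifts P)) (k : Fin n) {p : PosPath 0 T s₀ → Prop}
    (hp : ∀ᵐ ω ∂P, p ω) :
    ∀ᵐ ω ∂P, τ.time k.castSucc ω < τ.time k.succ ω → ∀ c ≠ 0, ∃ ω', p ω' ∧
      τ.Agree k.castSucc ω ω' ∧ 0 < c * (ω' (τ.time k.succ ω') - ω' (τ.time k.castSucc ω')) := by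
  obtain ⟨A₁, hA₁, hdelay⟩ := hτ.exists_delay_of_agree k
  obtain ⟨A₂, hA₂, htime⟩ := τ.isAEInvariant_time k.castSucc
  obtain ⟨A₃, hA₃, htime'⟩ := τ.isAEInvariant_time k.succ
  have hA : A₁ ∩ A₂ ∩ A₃ ∩ {ω | p ω} ∈ ae P :=
    inter_mem (inter_mem (inter_mem hA₁ hA₂) hA₃) hp
  filter_upwards [hA, hP.ae_isSteerable (inter_mem hA (hP.ae_isSteerable hA))]
  rintro ω ⟨⟨⟨hω₁, hω₂⟩, hω₃⟩, -⟩ hsteer hlt c hc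
  obtain ⟨V, hV, hVne, ε, hε, hdelayω⟩ := hdelay ω hω₁
  set t₀ := τ.time k.castSucc ω
  obtain ⟨b', hb', hb'ε⟩ : ∃ b' > t₀, (b' : ℝ) ≤ t₀ + ε :=
    ⟨⟨min (t₀ + ε) T, le_min (by linarith [t₀.2.1]) (t₀.2.1.trans t₀.2.2), min_le_right _ _⟩,
      lt_min (lt_add_of_pos_right _ hε) ((Subtype.coe_lt_coe.2 hlt).trans_le (τ.time k.succ ω).2.2),
      min_le_left _ _⟩
  obtain ⟨φ, ⟨⟨⟨hφ₁, -⟩, hφ₃⟩, -⟩, hωφ, htail, ω', ⟨⟨⟨-, hω'₂⟩, hω'₃⟩, hpω'⟩, b, ⟨hb, hbb'⟩,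
    hφω', hadverse⟩ := hsteer.exists_tail_mem_and_adverse hb' hV hVne hc
  obtain ⟨q, hq, hωφq⟩ := hωφ
  have hagree : τ.Agree k.castSucc ω ω' := ⟨min q b, lt_min hq hb, fun t ht =>
    (hωφq t (ht.trans (min_le_left _ _))).trans (hφω' t (ht.trans (min_le_right _ _))).symm⟩
  have hφlt : t₀ < τ.time k.succ φ := by
    by_contra! hle
    have := htime' φ hφ₃ ω hω₃ (PosPath.AgreePast.symm ⟨q, hle.trans_lt hq, hωφq⟩)
    exact (hlt.trans_le (this ▸ hle)).false
  have hφb : b < τ.time k.succ φ := hbb'.trans_le <| Subtype.coe_le_coe.1 <| by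
    linarith [hdelayω φ hφ₁ ⟨q, hq, hωφq⟩ htail hφlt]
  have hbω' : b ≤ τ.time k.succ ω' := by
    by_contra! hlt'
    exact (hφb.trans ((htime' ω' hω'₃ φ hφ₃ ⟨b, hlt', hφω'⟩).symm.trans_lt hlt')).false
  refine ⟨ω', hpω', hagree, mul_sub_pos_of_mul_log_sub_log_pos (ω'.2.1 _) (ω'.2.1 _) ?_⟩
  obtain ⟨q', hq', hωω'⟩ := hagree
  rw [← htime ω hω₂ ω' hω'₂ ⟨q', hq', hωω'⟩, ← hωω' t₀ hq'.le]
  exact hadverse _ hbω'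

end Steering

section NoArbitrage

variable {T s₀ : ℝ} {P : Measure (PosPath 0 T s₀)} {n : ℕ} {τ : StoppingSeq P n}

/-- The discrete stochastic integral of the positions `φ`: the wealth `V k` at the time `τₖ` starts
from zero, and `φ k` shares are held between `τₖ` and `τₖ₊₁`. -/
structure StoppingSeq.IsGains (τ : StoppingSeq P n) (φ : Fin n → PosPath 0 T s₀ → ℝ)
    (V : Fin (n + 1) → PosPath 0 T s₀ → ℝ) : Prop where
  measurable : ∀ k, Measurable[τ.sigma k.castSucc] (φ k)
  zero : ∀ᵐ ω ∂P, V 0 ω = 0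
  succ : ∀ k : Fin n, ∀ᵐ ω ∂P, V k.succ ω =
    V k.castSucc ω + φ k ω * (ω (τ.time k.succ ω) - ω (τ.time k.castSucc ω))

variable {φ : Fin n → PosPath 0 T s₀ → ℝ} {V : Fin (n + 1) → PosPath 0 T s₀ → ℝ}

theorem StoppingSeq.IsGains.isAEInvariant (hV : τ.IsGains φ V) (k : Fin (n + 1)) :
    IsAEInvariant P (τ.Agree k) (V k) := by
  induction k using Fin.induction with
  | zero => exact .of_ae_eq_const hV.zero
  | succ k ih =>
    have hk : k.castSucc ≤ k.succ := k.castSucc_lt_succ.le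
    have hearlier (ω ω') : τ.Agree k.succ ω ω' → τ.Agree k.castSucc ω ω' := .mono hk
    obtain ⟨A₁, hA₁, hVk⟩ := ih.mono hearlier
    obtain ⟨A₂, hA₂, hφk⟩ := (τ.isAEInvariant (hV.measurable k)).mono hearlier
    obtain ⟨A₃, hA₃, htime⟩ := (τ.isAEInvariant_time k.castSucc).mono hearlier
    obtain ⟨A₄, hA₄, htime'⟩ := τ.isAEInvariant_time k.succ
    refine ⟨A₁ ∩ A₂ ∩ A₃ ∩ A₄ ∩ {ω | _},
      inter_mem (inter_mem (inter_mem (inter_mem hA₁ hA₂) hA₃) hA₄) (hV.succ k), ?_⟩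
    rintro ω ⟨⟨⟨⟨h₁, h₂⟩, h₃⟩, h₄⟩, hsucc⟩ ω' ⟨⟨⟨⟨h'₁, h'₂⟩, h'₃⟩, h'₄⟩, hsucc'⟩ hagree
    obtain ⟨q, hq, hωω'⟩ := id hagree
    rw [hsucc, hsucc', hVk ω h₁ ω' h'₁ hagree, hφk ω h₂ ω' h'₂ hagree,
      ← htime ω h₃ ω' h'₃ hagree, ← htime' ω h₄ ω' h'₄ hagree, hωω' _ hq.le,
      hωω' _ ((τ.monotone ω hk).trans hq.le)]

/- If `φ k` were non-zero on a path along which time elapses, then an adverse continuation of this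
path would turn the wealth negative. -/
theorem StoppingSeq.IsGains.ae_succ_eq_castSucc (hV : τ.IsGains φ V) (hτ : τ.HasDelay)
    (hP : IsDenseInFuture (quasiInvariantShifts P)) {k : Fin n}
    (hk : ∀ᵐ ω ∂P, 0 ≤ V k.succ ω) :
    ∀ᵐ ω ∂P, V k.castSucc ω ≤ 0 → V k.succ ω = V k.castSucc ω := by
  obtain ⟨A₁, hA₁, hVk⟩ := hV.isAEInvariant k.castSucc
  obtain ⟨A₂, hA₂, hφk⟩ := τ.isAEInvariant (hV.measurable k)
  have hgood : ∀ᵐ ω ∂P, ω ∈ A₁ ∧ ω ∈ A₂ ∧ 0 ≤ V k.succ ω ∧ V k.succ ω =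
      V k.castSucc ω + φ k ω * (ω (τ.time k.succ ω) - ω (τ.time k.castSucc ω)) := by
    filter_upwards [hA₁, hA₂, hk, hV.succ k] with ω h₁ h₂ h₃ h₄ using ⟨h₁, h₂, h₃, h₄⟩
  filter_upwards [hgood, hτ.ae_exists_adverse_path hP k hgood]
    with ω ⟨hω₁, hω₂, _, hsucc⟩ hadverse hneg
  rcases (τ.monotone ω k.castSucc_lt_succ.le).eq_or_lt with heq | hlt
  · rw [hsucc, show τ.time k.castSucc ω = τ.time k.succ ω from heq, sub_self, mul_zero, add_zero]
  suffices φ k ω = 0 by rw [hsucc, this, zero_mul, add_zero]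
  by_contra hφ
  obtain ⟨ω', ⟨hω'₁, hω'₂, hnonneg, hsucc'⟩, hagree, hloss⟩ :=
    hadverse hlt (-φ k ω) (neg_ne_zero.2 hφ)
  rw [hsucc', ← hVk ω hω₁ ω' hω'₁ hagree, ← hφk ω hω₂ ω' hω'₂ hagree] at hnonneg
  linarith

theorem StoppingSeq.IsGains.ae_nonneg (hV : τ.IsGains φ V) (hτ : τ.HasDelay)
    (hP : IsDenseInFuture (quasiInvariantShifts P))
    (hlast : ∀ᵐ ω ∂P, 0 ≤ V (Fin.last n) ω) (k : Fin (n + 1)) : ∀ᵐ ω ∂P, 0 ≤ V k ω := by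
  induction k using Fin.reverseInduction with
  | last => exact hlast
  | cast k ih =>
    filter_upwards [ih, hV.ae_succ_eq_castSucc hτ hP ih] with ω hsucc hstep
    by_contra! hneg
    exact hneg.not_ge (hstep hneg.le ▸ hsucc)

theorem StoppingSeq.IsGains.ae_eq_zero (hV : τ.IsGains φ V) (hτ : τ.HasDelay)
    (hP : IsDenseInFuture (quasiInvariantShifts P))
    (hlast : ∀ᵐ ω ∂P, 0 ≤ V (Fin.last n) ω) (k : Fin (n + 1)) : ∀ᵐ ω ∂P, V k ω = 0 := by
  induction k using Fin.induction with
  | zero => exact hV.zero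
  | succ k ih =>
    filter_upwards [ih, hV.ae_succ_eq_castSucc hτ hP (hV.ae_nonneg hτ hP hlast k.succ)]
      with ω hzero hstep using (hstep hzero.le).trans hzero

theorem StoppingSeq.sum_indicator_eq (τ : StoppingSeq P n) (x : Fin n → ℝ) {ω : PosPath 0 T s₀}
    {k : Fin n} {t : Set.Icc (0 : ℝ) T}
    (ht : t ∈ Set.Ioc (τ.time k.castSucc ω) (τ.time k.succ ω)) :
    ∑ j : Fin n, (Set.Ioc (τ.time j.castSucc ω) (τ.time j.succ ω)).indicator (fun _ => x j) t =
      x k := by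
  refine (Finset.sum_eq_single k (fun j _ hjk => indicator_of_notMem (fun hj => ?_) _)
    fun hk => (hk (Finset.mem_univ k)).elim).trans (indicator_of_mem ht _)
  rcases hjk.lt_or_gt with hlt | hlt
  · exact (ht.1.trans_le (hj.2.trans (τ.monotone ω (Fin.succ_le_castSucc_iff.2 hlt)))).false
  · exact (hj.1.trans_le (ht.2.trans (τ.monotone ω (Fin.succ_le_castSucc_iff.2 hlt)))).false

theorem StoppingSeq.sum_indicator_eq_zero (τ : StoppingSeq P n) (x : Fin n → ℝ)
    {ω : PosPath 0 T s₀} {t : Set.Icc (0 : ℝ) T}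
    (ht : t ∉ Set.Ioc (τ.time 0 ω) (τ.time (Fin.last n) ω)) :
    ∑ j : Fin n, (Set.Ioc (τ.time j.castSucc ω) (τ.time j.succ ω)).indicator (fun _ => x j) t =
      0 :=
  Finset.sum_eq_zero fun _ _ => indicator_of_notMem (fun hj => ht
    (Set.Ioc_subset_Ioc (τ.monotone ω (Fin.zero_le _)) (τ.monotone ω (Fin.le_last _)) hj)) _

variable {hT : 0 < T} {Φ : Portfolio P}

theorem Portfolio.IsSimpleAlong.value_eq_value_startTime (hs : Φ.IsSimpleAlong hT τ)
    {ω : PosPath 0 T s₀} {t : Set.Icc (0 : ℝ) T} (ht : t ≤ τ.time 0 ω) :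
    Φ.value t ω = Φ.value (startTime hT) ω := by
  obtain ⟨⟨φ, -, hφ⟩, ψ₀, ψ, -, -, hψ⟩ := hs
  have hvalue (t) (ht : t ≤ τ.time 0 ω) : Φ.value t ω = ψ₀ ω := by
    have hnot : t ∉ Set.Ioc (τ.time 0 ω) (τ.time (Fin.last n) ω) := fun h => h.1.not_ge ht
    rw [Portfolio.value, hφ, hψ, τ.sum_indicator_eq_zero _ hnot, τ.sum_indicator_eq_zero _ hnot,
      indicator_of_mem (mem_Iic.2 ht),
      indicator_of_notMem (notMem_Ioi.2 (ht.trans (τ.monotone ω (Fin.zero_le _)))),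
      zero_mul, add_zero, add_zero, add_zero]
  rw [hvalue t ht, hvalue _ (τ.time 0 ω).2.1]

theorem Portfolio.IsSelfFinancingAlong.ae_value_endTime (hs : Φ.IsSimpleAlong hT τ)
    (hf : Φ.IsSelfFinancingAlong hT τ) :
    ∀ᵐ ω ∂P, Φ.value (endTime hT) ω = Φ.value (τ.time (Fin.last n) ω) ω := by
  obtain ⟨⟨φ, -, hφ⟩, -⟩ := hs
  filter_upwards [hf.2] with ω hω
  rw [← sub_eq_zero, hω]
  rcases (show τ.time (Fin.last n) ω ≤ endTime hT from (τ.time (Fin.last n) ω).2.2).eq_or_lt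
    with heq | hlt
  · rw [heq, sub_self, mul_zero]
  · rw [hφ, τ.sum_indicator_eq_zero _ fun h => h.2.not_gt hlt, zero_mul]

theorem Portfolio.IsSelfFinancingAlong.exists_isGains (hs : Φ.IsSimpleAlong hT τ)
    (hf : Φ.IsSelfFinancingAlong hT τ) (h0 : ∀ᵐ ω ∂P, Φ.value (startTime hT) ω = 0) :
    ∃ φ, τ.IsGains φ fun k ω => Φ.value (τ.time k ω) ω := by
  obtain ⟨φ, hφm, hφ⟩ := hs.1
  refine ⟨φ, hφm, h0.mono fun ω hω => (hs.value_eq_value_startTime le_rfl).trans hω, fun k => ?_⟩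
  filter_upwards [hf.1 k] with ω hω
  rw [← sub_eq_iff_eq_add', hω]
  rcases (τ.monotone ω k.castSucc_lt_succ.le).eq_or_lt with heq | hlt
  · rw [show τ.time k.castSucc ω = τ.time k.succ ω from heq, sub_self, mul_zero, mul_zero]
  · rw [hφ, τ.sum_indicator_eq _ ⟨hlt, le_rfl⟩]

theorem noArbitrageIn_delaySimple (hT : 0 < T) (hP : IsDenseInFuture (quasiInvariantShifts P)) :
    NoArbitrageIn hT (delaySimple hT P) := by
  rintro Φ ⟨n, τ, hτ, hs, hf⟩ ⟨h0, hend, hpos⟩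
  obtain ⟨φ, hV⟩ := hf.exists_isGains hs h0
  have hT' := hf.ae_value_endTime hs
  have hzero : ∀ᵐ ω ∂P, Φ.value (τ.time (Fin.last n) ω) ω = 0 :=
    hV.ae_eq_zero hτ hP (by filter_upwards [hend, hT'] with ω h h' using h' ▸ h) (Fin.last n)
  refine hpos.ne' (measure_eq_zero_iff_ae_notMem.2 ?_)
  filter_upwards [hT', hzero] with ω h h' hω
  exact hω.ne' (h.trans h')

end NoArbitrage

end DelaySimple

end

theorem mainTheorem1_general {E : Type*} [MeasurableSpace E] {Q : Measure E} {T s₀ H σ : ℝ}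
    (hT : 0 < T) {P : Measure (DelaySimple.PosPath 0 T s₀)} (hH : 0 < H) (hH1 : H < 1)
    (hσ : σ ≠ 0) {B Y : Set.Icc (0 : ℝ) T → E → ℝ} (hB : DelaySimple.IsFBm H B Q)
    (hY : ∀ t, AEMeasurable (Y t) Q) (hBY : IndepFun (fun e t => B t e) (fun e t => Y t e) Q)
    (hP : DelaySimple.IsPathLaw (fun t e => Real.exp (σ * B t e + Y t e)) Q P) :
    DelaySimple.NoArbitrageIn hT (DelaySimple.delaySimple hT P) :=
  DelaySimple.noArbitrageIn_delaySimple hT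
    (hP.isDenseInFuture_quasiInvariantShifts hH hH1 hσ hB hY hBY)

/-- The Black–Scholes, the fractional Black–Scholes and the mixed fractional Black–Scholes models
are free of arbitrage in the class of delay-simple strategies. -/
theorem mainTheorem1 {E : Type*} [MeasurableSpace E] (Q : Measure E) [IsProbabilityMeasure Q]
    (T s₀ μ : ℝ) (hT : 0 < T) (hs₀ : 0 < s₀)
    (P : Measure (DelaySimple.PosPath 0 T s₀)) :
    -- the Black–Scholes model
    (∀ (σ : ℝ) (W : Set.Icc (0 : ℝ) T → E → ℝ), 0 < σ → DelaySimple.IsBm W Q →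
      DelaySimple.IsPathLaw
        (fun t e => s₀ * Real.exp (μ * t + σ * W t e - σ ^ 2 / 2 * t)) Q P →
      DelaySimple.NoArbitrageIn hT (DelaySimple.delaySimple hT P)) ∧
    -- the fractional Black–Scholes model
    (∀ (ν H : ℝ) (B : Set.Icc (0 : ℝ) T → E → ℝ), 0 < ν → 0 < H → H < 1 → H ≠ 1 / 2 →
      DelaySimple.IsFBm H B Q →
      DelaySimple.IsPathLaw (fun t e => s₀ * Real.exp (μ * t + ν * B t e)) Q P →
      DelaySimple.NoArbitrageIn hT (DelaySimple.delaySimple hT P)) ∧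
    -- the mixed fractional Black–Scholes model
    (∀ (σ ν H : ℝ) (W B : Set.Icc (0 : ℝ) T → E → ℝ), 0 < σ → 0 < ν → 0 < H → H < 1 →
      H ≠ 1 / 2 → DelaySimple.IsBm W Q → DelaySimple.IsFBm H B Q →
      IndepFun (fun e t => W t e) (fun e t => B t e) Q →
      DelaySimple.IsPathLaw
        (fun t e => s₀ * Real.exp (μ * t + σ * W t e - σ ^ 2 / 2 * t + ν * B t e)) Q P →
      DelaySimple.NoArbitrageIn hT (DelaySimple.delaySimple hT P)) := by
  have hexp (x : ℝ) : s₀ * Real.exp x = Real.exp (Real.log s₀ + x) := by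
    rw [Real.exp_add, Real.exp_log hs₀]
  simp only [hexp]
  refine ⟨fun σ W hσ hW hP => ?_, fun ν H B hν hH hH1 _ hB hP => ?_,
    fun σ ν H W B hσ _ _ _ _ hW hB hWB hP => ?_⟩
  · refine mainTheorem1_general hT (by norm_num) (by norm_num) hσ.ne' hW
      (Y := fun t _ => Real.log s₀ + μ * t - σ ^ 2 / 2 * t) (fun _ => aemeasurable_const)
      (indepFun_const_right _ _) ?_
    convert hP using 4
    ring
  · refine mainTheorem1_general hT hH hH1 hν.ne' hB (Y := fun t _ => Real.log s₀ + μ * t)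
      (fun _ => aemeasurable_const) (indepFun_const_right _ _) ?_
    convert hP using 4
    ring
  · have hY : Measurable fun (x : Set.Icc (0 : ℝ) T → ℝ) t =>
        Real.log s₀ + μ * t - σ ^ 2 / 2 * t + ν * x t := by fun_prop
    refine mainTheorem1_general hT (by norm_num) (by norm_num) hσ.ne' hW
      (fun t => ((hB.gaussian.aemeasurable t).const_mul ν).const_add _)
      (hWB.comp measurable_id hY) ?_
    convert hP using 4
    ring
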